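/- **Setting.** Let $\langle z,w\rangle=i(\bar z_1w_3-\bar z_3w_1)+\bar z_2w_2$ on $\mathbb C^3$ (signature $(2,1)$), and let $\mathcal S=\{[z]\in\mathbb{CP}^2:\langle z,z\rangle=0\}$ be the CR 3-sphere with positive contact form $\zeta=-i\langle z,dz\rangle/|z|^2$. It is identified with the unit sphere $S^3\subset\mathbb C^2$ by $(z_1,z_2)\mapsto\left[\tfrac{1+z_1}{2},\tfrac{iz_2}{\sqrt2},\tfrac{i(1-z_1)}{2}\right]$. A smooth curve $\gamma=[\Gamma]:\mathbb R\to\mathcal S$ with smooth lift $\Gamma:\mathbb R\to\mathbb C^3\setminus\{0\}$ is *generic transversal* if $\zeta(\gamma')>0$ and $\det(\Gamma,\Gamma',\Gamma'')\ne0$ everywhere. It then has a lift $\Gamma$ with $\det(\Gamma,\Gamma',\Gamma'')=-1$ (a Wilczynski lift), and the parametrization is *natural* if $i\langle\Gamma,\Gamma'\rangle^{-1}=1$ for this lift. Every periodic generic transversal curve has a natural reparametrization; its *bending* and *twist* are $\kappa=\tfrac12\langle\Gamma',\Gamma'\rangle$ and $\tau=\operatorname{Im}\langle\Gamma'',\Gamma'\rangle+3\kappa^2$,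 computed with a Wilczynski lift of it. A periodic generic transversal curve with constant $\kappa,\tau$ is an *isoparametric string*; it is an *isoparametric knot* if moreover it is injective on $[0,\omega)$, where $\omega$ is its minimal period. Let $$H_{\kappa,\tau}=i\begin{pmatrix}i\kappa&-i&\tau\\0&-2i\kappa&1\\1&0&i\kappa\end{pmatrix},\qquad D_{\kappa,\tau}=-27+108\kappa(\kappa^2+\tau)-324\kappa^4\tau-72\kappa^2\tau^2-4\tau^3,$$ where $D_{\kappa,\tau}$ is the discriminant of the characteristic polynomial of $H_{\kappa,\tau}$. If $D_{\kappa,\tau}>0$, then $H_{\kappa,\tau}$ has real eigenvalues $e_1<e_2<e_3$, and the *spectral ratio* is $e_1/e_3$. An isoparametric string is of the *first class* if $D_{\kappa,\tau}>0$ and $3\kappa>|\tau|^{1/2}$. For coprime integers $p,q$, a subset of $\mathcal S\cong S^3$ is a *torus knot of type $(p,q)$* if it is smoothly ambient isotopic to $\left\{\tfrac1{\sqrt2}(e^{iqt},e^{ipt}):t\in\mathbb R\right\}$. It is *negative* (left-handed) if $p>0>q$. **Symmetrical configurations of the first kind.** Let $r\in\mathbb Q\cap(-2,-\tfrac12)$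 and $\rho\in(0,\sqrt2)$ satisfy $\rho<\sqrt{\frac{2(-3+2\sqrt{2-r-r^2})}{1+2r}}$. Put $$N=4+8r+12\rho^2+(1+2r)\rho^4,\qquad \mu=\frac{N}{N-2\left((2+3r-3r^2-2r^3)(-4\rho+\rho^5)\right)^{2/3}},\qquad a=\frac{\mu}{1-\mu},$$ $$\mathcal U=\begin{pmatrix}\frac1{\sqrt2}&0&\frac i{\sqrt2}\\0&1&0\\\frac i{\sqrt2}&0&\frac1{\sqrt2}\end{pmatrix},\qquad D=\operatorname{diag}\left(i(1+r)a,\,-ia,\,-ira\right),$$ and define $\gamma_{r,\rho}:\mathbb R\to\mathcal S$ by $\gamma_{r,\rho}(s)=\left[\mathcal U\exp(sD)\,\mathcal U^{-1}\,{}^t(1,\rho,\tfrac i2\rho^2)\right]$. **Proposition.** For all such $(r,\rho)$: 1. $\gamma_{r,\rho}$ is an isoparametric knot of the first class with spectral ratio $r$. 2. The trajectory of $\gamma_{r,\rho}$ is a negative torus knot of type $(p,q)$, where $p>0$ and $q<0$ are the coprime integers with $\frac pq=\frac{2+r}{1+2r}$. 3. The trajectory of $\gamma_{r,\rho}$ is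 contained in the standard Heisenberg cyclide $\mathcal T_\rho$, the orbit through $[{}^t(1,\rho,\tfrac i2\rho^2)]$ of the maximal torus of all matrices $$R(\theta_1,\theta_2)=\begin{pmatrix}\varepsilon\cos\frac{\theta_1}2&0&\varepsilon\sin\frac{\theta_1}2\\0&e^{\frac i3(\theta_1+2\theta_2)}&0\\-\varepsilon\sin\frac{\theta_1}2&0&\varepsilon\cos\frac{\theta_1}2\end{pmatrix},\qquad \varepsilon=e^{-\frac i6(\theta_1+2\theta_2)},\quad \theta_1,\theta_2\in\mathbb R.$$ -/

import Mathlib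

open Set
open scoped Matrix Manifold ContDiff LinearAlgebra.Projectivization

noncomputable section

namespace CRKnots

/-! ### The pseudohermitian space, the projective plane and the CR sphere -/

/-- The complex vector space underlying the pseudohermitian space of signature `(2,1)`. -/
abbrev C21 : Type := Fin 3 → ℂ

/-- The complex projective plane. -/
abbrev CP2 : Type := ℙ ℂ C21

/-- The Hermitian scalar product of signature `(2,1)`, antilinear in the first entry:
`⟨z, w⟩ = i (conj z₁ w₃ - conj z₃ w₁) + conj z₂ w₂`. -/
def herm (z w : C21) : ℂ :=
  Complex.I * (star (z 0) * w 2 - star (z 2) * w 0) + star (z 1) * w 1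

/-- The value at a tangent vector of the positive contact form `ζ = -i⟨z, dz⟩ / (conj z · z)` of
the sphere `⟨z, z⟩ = 0` in the projective plane; `z` is a lightlike representative of the point and
`w` the derivative of a lift. On such vectors `⟨z, w⟩` is purely imaginary. -/
def contactForm (z w : C21) : ℝ :=
  (-Complex.I * herm z w).re / ∑ i, ‖z i‖ ^ 2

/-! ### Transversal curves -/

/-- `Γ` is a smooth lift of the curve `γ` to the cone of lightlike vectors. In particular `γ` is a
smooth curve in the sphere of all lightlike lines. -/
def IsSmoothLift (Γ : ℝ → C21) (γ : ℝ → CP2) : Prop :=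
  ContDiff ℝ ∞ Γ ∧ ∀ t, herm (Γ t) (Γ t) = 0 ∧ ∃ h : Γ t ≠ 0, γ t = Projectivization.mk ℂ (Γ t) h

/-- The Wronskian `det(Γ, Γ', Γ'')`. -/
def wronskian (Γ : ℝ → C21) (t : ℝ) : ℂ :=
  Matrix.det (Matrix.of ![Γ t, deriv Γ t, deriv (deriv Γ) t])ᵀ

/-- A generic transversal curve: a smooth curve in the sphere, positively transversal to the contact
distribution, without CR inflection points. Both conditions do not depend on the lift. -/
def IsGenericTransversal (γ : ℝ → CP2) : Prop :=
  ∃ Γ : ℝ → C21, IsSmoothLift Γ γ ∧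
    ∀ t, 0 < contactForm (Γ t) (deriv Γ t) ∧ wronskian Γ t ≠ 0

/-- Wilczynski lifts. -/
def IsWLift (Γ : ℝ → C21) (γ : ℝ → CP2) : Prop :=
  IsSmoothLift Γ γ ∧ ∀ t, wronskian Γ t = -1

/-- The strain density `i ⟨Γ, Γ'⟩⁻¹` computed with a Wilczynski lift `Γ`. -/
def strainDensity (Γ : ℝ → C21) (t : ℝ) : ℂ :=
  Complex.I * (herm (Γ t) (deriv Γ t))⁻¹

/-- `γ` is a natural parametrization (strain density `1`) with bending `κ` and twist `τ`. -/
def IsNaturalWith (γ : ℝ → CP2) (κ τ : ℝ → ℝ) : Prop :=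
  ∃ Γ : ℝ → C21, IsWLift Γ γ ∧ (∀ s, strainDensity Γ s = 1) ∧
    ∀ s, (κ s : ℂ) = 1 / 2 * herm (deriv Γ s) (deriv Γ s) ∧
      τ s = (herm (deriv (deriv Γ) s) (deriv Γ s)).im + 3 * κ s ^ 2

/-- A periodic generic transversal curve whose bending and twist are the constants `κ` and `τ`.
Bending and twist are those of a natural reparametrization `γ ∘ h`; as the curve is closed, its
natural parameter runs over the whole real line. -/
def IsIsoparametricString (γ : ℝ → CP2) (κ τ : ℝ) : Prop :=
  IsGenericTransversal γ ∧ (∃ T : ℝ, 0 < T ∧ Function.Periodic γ T) ∧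
    ∃ h : ℝ → ℝ, ContDiff ℝ ∞ h ∧ (∀ t, 0 < deriv h t) ∧ Function.Surjective h ∧
      IsNaturalWith (γ ∘ h) (fun _ => κ) (fun _ => τ)

/-- An isoparametric string with bending `κ` and twist `τ` that is a knot: it is injective on
`[0, T)`, where `T` is the minimal period. -/
def IsIsoparametricKnot (γ : ℝ → CP2) (κ τ : ℝ) : Prop :=
  IsIsoparametricString γ κ τ ∧
    ∃ T : ℝ, IsLeast {T' : ℝ | 0 < T' ∧ Function.Periodic γ T'} T ∧ InjOn γ (Ico 0 T)

/-! ### The Hamiltonian, the spectral ratio and the two classes -/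

/-- The infinitesimal generator `K` with bending `κ` and twist `τ`. -/
def generator (κ τ : ℝ) : Matrix (Fin 3) (Fin 3) ℂ :=
  !![Complex.I * κ, -Complex.I, τ;
     0, -2 * Complex.I * κ, 1;
     1, 0, Complex.I * κ]

/-- The Hamiltonian `i K`. -/
def hamiltonian (κ τ : ℝ) : Matrix (Fin 3) (Fin 3) ℂ :=
  Complex.I • generator κ τ

/-- The discriminant of the characteristic polynomial of the Hamiltonian. -/
def discriminant (κ τ : ℝ) : ℝ :=
  -27 + 108 * κ * (κ ^ 2 + τ) - 324 * κ ^ 4 * τ - 72 * κ ^ 2 * τ ^ 2 - 4 * τ ^ 3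

/-- The discriminant is positive and `r = e₁ / e₃`, where `e₁ < e₂ < e₃` are the three real
eigenvalues of the Hamiltonian. -/
def HasSpectralRatio (κ τ r : ℝ) : Prop :=
  0 < discriminant κ τ ∧ ∃ e₁ e₂ e₃ : ℝ, e₁ < e₂ ∧ e₂ < e₃ ∧
    spectrum ℂ (hamiltonian κ τ) = {(e₁ : ℂ), (e₂ : ℂ), (e₃ : ℂ)} ∧ r = e₁ / e₃

/-- The pairs (bending, twist) of the first class. -/
def IsFirstClass (κ τ : ℝ) : Prop :=
  0 < discriminant κ τ ∧ Real.sqrt |τ| < 3 * κ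

/-! ### The maximal torus and its orbits -/

/-- The element with Clifford angles `θ₁`, `θ₂` of the maximal torus. -/
def torusElement (θ₁ θ₂ : ℝ) : Matrix (Fin 3) (Fin 3) ℂ :=
  !![Complex.exp (-Complex.I / 6 * (θ₁ + 2 * θ₂)) * Complex.cos (θ₁ / 2), 0,
      Complex.exp (-Complex.I / 6 * (θ₁ + 2 * θ₂)) * Complex.sin (θ₁ / 2);
     0, Complex.exp (Complex.I / 3 * (θ₁ + 2 * θ₂)), 0;
     -Complex.exp (-Complex.I / 6 * (θ₁ + 2 * θ₂)) * Complex.sin (θ₁ / 2), 0,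
      Complex.exp (-Complex.I / 6 * (θ₁ + 2 * θ₂)) * Complex.cos (θ₁ / 2)]

/-- The lightlike vector `(1, ρ, i ρ² / 2)`. -/
def basePoint (ρ : ℝ) : C21 :=
  ![1, (ρ : ℂ), Complex.I * (ρ : ℂ) ^ 2 / 2]

/-- The orbit of the maximal torus through `[(1, ρ, i ρ² / 2)]`; for `0 < ρ < √2` this is the
standard Heisenberg cyclide with parameter `ρ`. -/
def heisenbergCyclide (ρ : ℝ) : Set CP2 :=
  {x | ∃ (θ₁ θ₂ : ℝ) (h : torusElement θ₁ θ₂ *ᵥ basePoint ρ ≠ 0),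
    x = Projectivization.mk ℂ (torusElement θ₁ θ₂ *ᵥ basePoint ρ) h}

/-! ### Symmetrical configurations of the first kind -/

/-- The domain of the parameters `(r, ρ)`. -/
def paramDomain : Set (ℝ × ℝ) :=
  {x | x.1 ∈ Ioo (-2 : ℝ) (-1 / 2) ∧ x.2 ∈ Ioo (0 : ℝ) (Real.sqrt 2) ∧
    x.2 < Real.sqrt (2 * (-3 + 2 * Real.sqrt (2 - x.1 - x.1 ^ 2)) / (1 + 2 * x.1))}

/-- The function `μ₁`. On the domain of the parameters the base of the fractional power is
positive. -/
def mu (r ρ : ℝ) : ℝ :=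
  (4 + 8 * r + 12 * ρ ^ 2 + (1 + 2 * r) * ρ ^ 4) /
    (4 + 8 * r + 12 * ρ ^ 2 + (1 + 2 * r) * ρ ^ 4 -
      2 * ((2 + 3 * r - 3 * r ^ 2 - 2 * r ^ 3) * (-4 * ρ + ρ ^ 5)) ^ (2 / 3 : ℝ))

/-- The smallest of the exponents `e₁ < e₂ < e₃`. -/
def ev₁ (r ρ : ℝ) : ℝ := r * (mu r ρ / (1 - mu r ρ))

/-- The middle exponent `e₂`. -/
def ev₂ (r ρ : ℝ) : ℝ := -(1 + r) * (mu r ρ / (1 - mu r ρ))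

/-- The largest exponent `e₃`. -/
def ev₃ (r ρ : ℝ) : ℝ := mu r ρ / (1 - mu r ρ)

/-- The diagonal matrix with entries `-i e₂`, `-i e₃`, `-i e₁`. -/
def diagD (r ρ : ℝ) : Matrix (Fin 3) (Fin 3) ℂ :=
  Matrix.diagonal ![-Complex.I * ev₂ r ρ, -Complex.I * ev₃ r ρ, -Complex.I * ev₁ r ρ]

/-- The matrix whose columns are the standard pseudo-unitary basis, timelike vector first. -/
def basisU : Matrix (Fin 3) (Fin 3) ℂ :=
  !![1 / (Real.sqrt 2 : ℂ), 0, Complex.I / (Real.sqrt 2 : ℂ);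
     0, 1, 0;
     Complex.I / (Real.sqrt 2 : ℂ), 0, 1 / (Real.sqrt 2 : ℂ)]

/-- The one-parameter group `U exp(s D) U⁻¹`. -/
def oneParam (r ρ s : ℝ) : Matrix (Fin 3) (Fin 3) ℂ :=
  basisU * NormedSpace.exp ((s : ℂ) • diagD r ρ) * basisU⁻¹

theorem isUnit_basisU : IsUnit basisU := by
  rw [Matrix.isUnit_iff_isUnit_det, isUnit_iff_ne_zero]
  have h2 : ((Real.sqrt 2 : ℝ) : ℂ) ^ 2 = 2 := by
    rw [← Complex.ofReal_pow, Real.sq_sqrt (by norm_num)]; norm_num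
  have h : basisU.det = 1 := by
    have h0 : ((Real.sqrt 2 : ℝ) : ℂ) ≠ 0 := by
      intro h; rw [h] at h2; norm_num at h2
    simp [basisU, Matrix.det_fin_three]
    field_simp
    rw [h2, Complex.I_sq]; norm_num
  rw [h]; exact one_ne_zero

theorem oneParam_mulVec_ne_zero (r ρ s : ℝ) : oneParam r ρ s *ᵥ basePoint ρ ≠ 0 := by
  have hu : IsUnit (oneParam r ρ s) :=
    (isUnit_basisU.mul (Matrix.isUnit_exp _)).mul
      ((Matrix.isUnit_nonsing_inv_iff).2 isUnit_basisU)
  intro h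
  have h1 : basePoint ρ = 0 := by
    apply Matrix.mulVec_injective_of_isUnit hu
    simpa using h
  have h2 := congrFun h1 0
  simp [basePoint] at h2

/-- The curve `γ_{r,ρ}`, the orbit of the one-parameter group through `[(1, ρ, i ρ² / 2)]`. When
`(r, ρ)` is in the domain of the parameters and `r` is rational, this is the symmetrical
configuration of the first kind with parameters `(r, ρ)`. -/
def symmConfig (r ρ : ℝ) (s : ℝ) : CP2 :=
  Projectivization.mk ℂ (oneParam r ρ s *ᵥ basePoint ρ) (oneParam_mulVec_ne_zero r ρ s)

/-! ### Torus knots -/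

/-- The unit sphere of `ℂ² = ℝ⁴`, with complex coordinates `z₁ = x₁ + i y₁`, `z₂ = x₂ + i y₂`
for a point `(x₁, y₁, x₂, y₂)`. -/
abbrev S3 : Type := Metric.sphere (0 : EuclideanSpace ℝ (Fin 4)) 1

/-- The first complex coordinate. -/
def S3.z₁ (x : S3) : ℂ := ⟨x.1 0, x.1 1⟩

/-- The second complex coordinate. -/
def S3.z₂ (x : S3) : ℂ := ⟨x.1 2, x.1 3⟩

/-- A vector that represents the image of a point under the identification of the unit sphere with
the sphere of lightlike lines. -/
def sphereVec (x : S3) : C21 :=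
  ![(1 + x.z₁) / 2, Complex.I * x.z₂ / (Real.sqrt 2 : ℂ), Complex.I * (1 - x.z₁) / 2]

theorem sphereVec_ne_zero (x : S3) : sphereVec x ≠ 0 := by
  intro h
  have h0 := congrFun h 0
  have h2 := congrFun h 2
  simp [sphereVec] at h0 h2
  have h3 : (2 : ℂ) = 0 := by linear_combination h0 + h2
  norm_num at h3

/-- The identification of the unit sphere of `ℂ²` with the sphere of lightlike lines. It is the
restriction of an affine chart, so it respects the CR structures and the orientations; the circle
`z₂ = 0` goes to the axis of the rotations `torusElement 0 θ₂`. -/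
def sphereMap (x : S3) : CP2 :=
  Projectivization.mk ℂ (sphereVec x) (sphereVec_ne_zero x)

/-- Two subsets of the 3-sphere are ambient isotopic: there is a smooth isotopy of the 3-sphere
through diffeomorphisms, starting at the identity, that carries the first to the second. -/
def AmbientIsotopic (K L : Set S3) : Prop :=
  ∃ H : ℝ → (S3 ≃ₘ^∞⟮𝓡 3, 𝓡 3⟯ S3),
    ContMDiff (𝓘(ℝ, ℝ).prod (𝓡 3)) (𝓡 3) ∞ (fun x : ℝ × S3 => H x.1 x.2) ∧
      (∀ x, H 0 x = x) ∧ H 1 '' K = L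

/-- The standard curve of type `(p, q)` on the Clifford torus, `z₁ = exp(i q t) / √2`,
`z₂ = exp(i p t) / √2`: it turns `p` times around the circle `z₂ = 0` and `q` times around the
circle `z₁ = 0`. It is right-handed for `p q > 0` and left-handed for `p q < 0`. -/
def standardTorusKnot (p q : ℤ) : Set S3 :=
  {x | ∃ t : ℝ, x.z₁ = Complex.exp (Complex.I * q * t) / (Real.sqrt 2 : ℂ) ∧
    x.z₂ = Complex.exp (Complex.I * p * t) / (Real.sqrt 2 : ℂ)}

/-- A subset of the sphere of lightlike lines is a torus knot of type `(p, q)`. -/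
def IsTorusKnot (p q : ℤ) (K : Set CP2) : Prop :=
  IsCoprime p q ∧ K ⊆ range sphereMap ∧
    AmbientIsotopic (sphereMap ⁻¹' K) (standardTorusKnot p q)

end CRKnots

end

/-!
The matrix `basisU` diagonalizes both the Hermitian form, which becomes `diag(-1, 1, 1)`, and the
one-parameter group, so a lift of the curve has coordinates `w j * exp (-i e j s)` with constant
coefficients. Hence its Wronskian and the Hermitian products of its derivatives are constant: the
latter are the moments `∑ W j * e j ^ k` of the exponents with the weights `W j = ± |w j| ^ 2`. The
choice of `mu` in the definition of the exponents is exactly the one for which a single real scale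
`l` brings the Wronskian to `-1` and the first moment to `-1` (`exists_scale`); so `s` itself is the
natural parameter. With the zeroth and first moment and the Hankel determinant of the moments known,
the elementary symmetric functions of the exponents are those polynomials in bending and twist that
appear in the characteristic polynomial of the Hamiltonian (`symmetric_functions_of_moments`). So
the exponents are its eigenvalues, their ratio is `r` by construction, and the first-class condition
becomes an elementary inequality in `r` and `ρ` (`bending_bound`) which uses only that the numerator
of `mu` is negative on the domain of the parameters.

In the coordinates of the unit sphere of `ℂ²` the curve is
`(A exp (-i q b s), -i B exp (-i p b s))` with `A² + B² = 1`, `A, B > 0` and a common frequency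
`b > 0`, where `p / q = (2 + r) / (1 + 2 r)`
(`exists_common_frequency`, `exists_sphereMap_eq_of_frequency`). As `p` and `q` are coprime, the
curve has minimal period `2 π / b` and is injective on a period (`symmConfig_eq_iff`). The linear
maps `(z₁, z₂) ↦ ((B / A) ^ σ z₁, exp (i π σ / 2) z₂)` act on the rays of `ℂ²`, that is, on the unit
sphere, and form an isotopy to the standard torus knot (`ambientIsotopic_standardTorusKnot`).
Finally, the one-parameter group lies in the maximal torus (`torusElement_mulVec_basePoint`).
-/

namespace CRKnots

/-! ### Exponential curves in the pseudo-unitary basis -/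

theorem sqrt_two_sq : ((Real.sqrt 2 : ℝ) : ℂ) ^ 2 = 2 := by
  rw [← Complex.ofReal_pow, Real.sq_sqrt (by norm_num)]; norm_num

theorem sqrt_two_ne_zero : ((Real.sqrt 2 : ℝ) : ℂ) ≠ 0 := by
  intro h
  have h2 := sqrt_two_sq
  rw [h] at h2; norm_num at h2

theorem det_basisU : basisU.det = 1 := by
  have h0 := sqrt_two_ne_zero
  simp [basisU, Matrix.det_fin_three]
  field_simp
  rw [sqrt_two_sq, Complex.I_sq]; norm_num

/-- The Hermitian form `diag(-1, 1, 1)`, which is `herm` in the basis formed by the columns of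
`basisU`. -/
def diagForm (y y' : C21) : ℂ :=
  -(star (y 0) * y' 0) + star (y 1) * y' 1 + star (y 2) * y' 2

theorem herm_basisU_mulVec (y y' : C21) :
    herm (basisU *ᵥ y) (basisU *ᵥ y') = diagForm y y' := by
  have h0 := sqrt_two_ne_zero
  simp [herm, diagForm, basisU, Matrix.mulVec, dotProduct, Fin.sum_univ_three]
  field_simp
  linear_combination ((starRingEnd ℂ) (y 0) * y' 0 - (starRingEnd ℂ) (y 2) * y' 2) * sqrt_two_sq +
    (2 * (starRingEnd ℂ) (y 0) * y' 0 - 2 * (starRingEnd ℂ) (y 2) * y' 2 +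
      Complex.I * ((starRingEnd ℂ) (y 0) * y' 2 - (starRingEnd ℂ) (y 2) * y' 0)) * Complex.I_sq

/-- The curve whose `j`-th coordinate in the basis of the columns of `basisU` is
`w j * exp (-i e j s)`. -/
noncomputable def orbitCurve (w : C21) (e : Fin 3 → ℝ) (s : ℝ) : C21 :=
  basisU *ᵥ fun j => w j * Complex.exp (-Complex.I * e j * s)

/-- The coefficients of the derivative of `orbitCurve w e`. -/
def derivCoeff (w : C21) (e : Fin 3 → ℝ) : C21 := fun j => -Complex.I * e j * w j

theorem hasDerivAt_orbitCurve (w : C21) (e : Fin 3 → ℝ) (s : ℝ) :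
    HasDerivAt (orbitCurve w e) (orbitCurve (derivCoeff w e) e s) s := by
  have h : HasDerivAt (fun s : ℝ => fun j => w j * Complex.exp (-Complex.I * e j * s))
      (fun j => derivCoeff w e j * Complex.exp (-Complex.I * e j * s)) s := by
    rw [hasDerivAt_pi]
    intro j
    have h1 : HasDerivAt (fun s : ℝ => -Complex.I * e j * (s : ℂ)) (-Complex.I * e j) s := by
      have h2 := (Complex.ofRealCLM.hasDerivAt (x := s)).const_mul (-Complex.I * (e j : ℂ))
      rwa [Complex.ofRealCLM_apply, Complex.ofReal_one, mul_one] at h2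
    exact (h1.cexp.const_mul (w j)).congr_deriv (by simp only [derivCoeff]; ring)
  exact ((Matrix.mulVecLin basisU).restrictScalars ℝ).toContinuousLinearMap.hasFDerivAt.comp_hasDerivAt
    s h

theorem deriv_orbitCurve (w : C21) (e : Fin 3 → ℝ) :
    deriv (orbitCurve w e) = orbitCurve (derivCoeff w e) e :=
  funext fun s => (hasDerivAt_orbitCurve w e s).deriv

theorem contDiff_orbitCurve (w : C21) (e : Fin 3 → ℝ) : ContDiff ℝ ∞ (orbitCurve w e) := by
  have h : ContDiff ℝ ∞ (fun s : ℝ => fun j => w j * Complex.exp (-Complex.I * e j * s)) := by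
    rw [contDiff_pi]
    intro j
    have : ContDiff ℝ ∞ (fun s : ℝ => (s : ℂ)) := Complex.ofRealCLM.contDiff
    fun_prop
  exact ((Matrix.mulVecLin basisU).restrictScalars ℝ).toContinuousLinearMap.contDiff.comp h

theorem herm_orbitCurve (w w' : C21) (e : Fin 3 → ℝ) (s : ℝ) :
    herm (orbitCurve w e s) (orbitCurve w' e s) = diagForm w w' := by
  have h : ∀ j, star (Complex.exp (-Complex.I * e j * s)) * Complex.exp (-Complex.I * e j * s)
      = 1 := by
    intro j
    rw [Complex.star_def, ← Complex.exp_conj, ← Complex.exp_add]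
    simp
  rw [orbitCurve, orbitCurve, herm_basisU_mulVec]
  simp only [diagForm, star_mul']
  linear_combination -(star (w 0) * w' 0) * h 0 + (star (w 1) * w' 1) * h 1 +
    (star (w 2) * w' 2) * h 2

theorem orbitCurve_smul (k : ℂ) (w : C21) (e : Fin 3 → ℝ) (s : ℝ) :
    orbitCurve (k • w) e s = k • orbitCurve w e s := by
  simp only [orbitCurve, ← Matrix.mulVec_smul]
  congr 1
  ext j
  simp [mul_assoc]

theorem wronskian_orbitCurve (w : C21) (e : Fin 3 → ℝ) (he : e 0 + e 1 + e 2 = 0) (s : ℝ) :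
    wronskian (orbitCurve w e) s =
      Complex.I * (w 0 * w 1 * w 2) * ((e 1 - e 0) * (e 2 - e 0) * (e 2 - e 1)) := by
  have hexp : Complex.exp (-Complex.I * e 0 * s) * Complex.exp (-Complex.I * e 1 * s) *
      Complex.exp (-Complex.I * e 2 * s) = 1 := by
    rw [← Complex.exp_add, ← Complex.exp_add]
    have : (e 0 : ℂ) + e 1 + e 2 = 0 := by exact_mod_cast he
    rw [show -Complex.I * e 0 * s + -Complex.I * e 1 * s + -Complex.I * e 2 * s = 0 by
      linear_combination (-Complex.I * s) * this]
    exact Complex.exp_zero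
  have hmat : (Matrix.of ![orbitCurve w e s, deriv (orbitCurve w e) s,
      deriv (deriv (orbitCurve w e)) s])ᵀ = basisU * (Matrix.of
        ![fun j => w j * Complex.exp (-Complex.I * e j * s),
          fun j => derivCoeff w e j * Complex.exp (-Complex.I * e j * s),
          fun j => derivCoeff (derivCoeff w e) e j * Complex.exp (-Complex.I * e j * s)])ᵀ := by
    rw [deriv_orbitCurve, deriv_orbitCurve]
    ext i j
    fin_cases j <;> rfl
  rw [wronskian, hmat, Matrix.det_mul, det_basisU, one_mul, Matrix.det_transpose,
    Matrix.det_fin_three]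
  simp only [Matrix.of_apply, Matrix.cons_val_zero, Matrix.cons_val_one, Matrix.cons_val,
    derivCoeff]
  linear_combination (-Complex.I ^ 3 * (w 0 * w 1 * w 2) *
    ((e 1 - e 0) * (e 2 - e 0) * (e 2 - e 1))) * hexp +
    (-Complex.I * (w 0 * w 1 * w 2) * ((e 1 - e 0) * (e 2 - e 0) * (e 2 - e 1))) * Complex.I_sq

/-- The coordinates of `basePoint ρ` in the basis of the columns of `basisU`. -/
noncomputable def baseCoord (ρ : ℝ) : C21 :=
  ![(2 + ρ ^ 2) / (2 * (Real.sqrt 2 : ℂ)), ρ, -Complex.I * (2 - ρ ^ 2) / (2 * (Real.sqrt 2 : ℂ))]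

/-- The exponents `e₂, e₃, e₁`, in the order in which they occur in `diagD`. -/
noncomputable def exponents (r ρ : ℝ) : Fin 3 → ℝ := ![ev₂ r ρ, ev₃ r ρ, ev₁ r ρ]

theorem basisU_mulVec_baseCoord (ρ : ℝ) : basisU *ᵥ baseCoord ρ = basePoint ρ := by
  have h0 := sqrt_two_ne_zero
  ext j
  fin_cases j <;>
    simp [basisU, baseCoord, basePoint, Matrix.mulVec, dotProduct, Fin.sum_univ_three] <;>
    field_simp
  · linear_combination (2 - (ρ : ℂ) ^ 2) * Complex.I_sq * (-1) - 2 * sqrt_two_sq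
  · linear_combination (-(ρ : ℂ) ^ 2) * sqrt_two_sq

theorem oneParam_mulVec (r ρ s : ℝ) :
    oneParam r ρ s *ᵥ basePoint ρ = orbitCurve (baseCoord ρ) (exponents r ρ) s := by
  have hdet : IsUnit basisU.det := (Matrix.isUnit_iff_isUnit_det _).1 isUnit_basisU
  rw [oneParam, ← basisU_mulVec_baseCoord, Matrix.mulVec_mulVec, Matrix.mul_assoc,
    Matrix.nonsing_inv_mul _ hdet, Matrix.mul_one, ← Matrix.mulVec_mulVec, orbitCurve, diagD,
    ← Matrix.diagonal_smul, Matrix.exp_diagonal]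
  congr 1
  ext j
  rw [Matrix.mulVec_diagonal, Pi.coe_exp, ← Complex.exp_eq_exp_ℂ, mul_comm]
  fin_cases j <;> simp [exponents] <;> ring_nf <;> simp

/-! ### The spectrum of the Hamiltonian from the moments of the exponents -/

/-- The moments `∑ w j * e j ^ k` of three weighted exponents determine the elementary symmetric
functions of the exponents: reducing the third and the fourth moment by the cubic equation of the
exponents, the Hankel determinant `w₀ w₁ w₂ V²`, with `V` the Vandermonde product, becomes a
polynomial in the second moment and the symmetric functions. -/
theorem symmetric_functions_of_moments {w₀ w₁ w₂ e₀ e₁ e₂ κ τ : ℝ} (he : e₀ + e₁ + e₂ = 0)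
    (h0 : w₀ + w₁ + w₂ = 0) (h1 : w₀ * e₀ + w₁ * e₁ + w₂ * e₂ = -1)
    (hV : w₀ * w₁ * w₂ * ((e₁ - e₀) * (e₂ - e₀) * (e₂ - e₁)) ^ 2 = -1)
    (hκ : κ = 1 / 2 * (w₀ * e₀ ^ 2 + w₁ * e₁ ^ 2 + w₂ * e₂ ^ 2))
    (hτ : τ = w₀ * e₀ ^ 3 + w₁ * e₁ ^ 3 + w₂ * e₂ ^ 3 + 3 * κ ^ 2) :
    e₀ * e₁ + e₀ * e₂ + e₁ * e₂ = τ - 3 * κ ^ 2 ∧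
      e₀ * e₁ * e₂ = 2 * κ ^ 3 + 2 * κ * τ - 1 := by
  obtain rfl : e₂ = -e₀ - e₁ := by linarith
  obtain rfl : w₂ = -w₀ - w₁ := by linarith
  have hσ : e₀ * e₁ + e₀ * (-e₀ - e₁) + e₁ * (-e₀ - e₁) = τ - 3 * κ ^ 2 := by
    rw [hτ]
    linear_combination (e₀ * e₁ + e₀ * (-e₀ - e₁) + e₁ * (-e₀ - e₁)) * h1
  refine ⟨hσ, ?_⟩
  have hτ' : τ = e₀ * e₁ + e₀ * (-e₀ - e₁) + e₁ * (-e₀ - e₁) + 3 * κ ^ 2 := by linarith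
  have hankel : ∀ M₁ M₂ M₃ M₄ : ℝ,
      M₁ = w₀ * e₀ + w₁ * e₁ + (-w₀ - w₁) * (-e₀ - e₁) →
      M₂ = w₀ * e₀ ^ 2 + w₁ * e₁ ^ 2 + (-w₀ - w₁) * (-e₀ - e₁) ^ 2 →
      M₃ = w₀ * e₀ ^ 3 + w₁ * e₁ ^ 3 + (-w₀ - w₁) * (-e₀ - e₁) ^ 3 →
      M₄ = w₀ * e₀ ^ 4 + w₁ * e₁ ^ 4 + (-w₀ - w₁) * (-e₀ - e₁) ^ 4 →
      2 * M₁ * M₂ * M₃ - M₁ ^ 2 * M₄ - M₂ ^ 3 = -1 := by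
    rintro _ _ _ _ rfl rfl rfl rfl
    rw [← hV]; ring
  have h := hankel (-1) (2 * κ) (e₀ * e₁ + e₀ * (-e₀ - e₁) + e₁ * (-e₀ - e₁))
    (-(e₀ * e₁ + e₀ * (-e₀ - e₁) + e₁ * (-e₀ - e₁)) * (2 * κ) - e₀ * e₁ * (-e₀ - e₁))
    h1.symm (by rw [hκ]; ring)
    (by linear_combination (e₀ * e₁ + e₀ * (-e₀ - e₁) + e₁ * (-e₀ - e₁)) * h1)
    (by rw [hκ]; linear_combination (e₀ * e₁ * (-e₀ - e₁)) * (-1) * h1)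
  rw [hτ']
  linear_combination h

theorem spectrum_hamiltonian {κ τ e₀ e₁ e₂ : ℝ} (he : e₀ + e₁ + e₂ = 0)
    (h2 : e₀ * e₁ + e₀ * e₂ + e₁ * e₂ = τ - 3 * κ ^ 2)
    (h3 : e₀ * e₁ * e₂ = 2 * κ ^ 3 + 2 * κ * τ - 1) :
    spectrum ℂ (hamiltonian κ τ) = {(e₀ : ℂ), (e₁ : ℂ), (e₂ : ℂ)} := by
  have he' : (e₀ : ℂ) + e₁ + e₂ = 0 := by exact_mod_cast he
  have h2' : (e₀ : ℂ) * e₁ + e₀ * e₂ + e₁ * e₂ = τ - 3 * κ ^ 2 := by exact_mod_cast h2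
  have h3' : (e₀ : ℂ) * e₁ * e₂ = 2 * κ ^ 3 + 2 * κ * τ - 1 := by exact_mod_cast h3
  ext z
  have hdet : (algebraMap ℂ (Matrix (Fin 3) (Fin 3) ℂ) z - hamiltonian κ τ).det =
      (z - e₀) * (z - e₁) * (z - e₂) := by
    rw [Matrix.det_fin_three]
    simp [hamiltonian, generator, Matrix.algebraMap_matrix_apply]
    have hI := Complex.I_sq
    ring_nf
    simp only [show Complex.I ^ 4 = 1 by rw [show (4:ℕ) = 2 * 2 by rfl, pow_mul, hI]; ring,
      show Complex.I ^ 6 = -1 by rw [show (6:ℕ) = 2 * 3 by rfl, pow_mul, hI]; ring, hI]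
    linear_combination z ^ 2 * he' - z * h2' + h3'
  rw [spectrum.mem_iff, Matrix.isUnit_iff_isUnit_det, hdet, isUnit_iff_ne_zero, not_not]
  simp [sub_eq_zero, or_assoc]

theorem discriminant_eq {κ τ e₀ e₁ e₂ : ℝ} (he : e₀ + e₁ + e₂ = 0)
    (h2 : e₀ * e₁ + e₀ * e₂ + e₁ * e₂ = τ - 3 * κ ^ 2)
    (h3 : e₀ * e₁ * e₂ = 2 * κ ^ 3 + 2 * κ * τ - 1) :
    discriminant κ τ = ((e₁ - e₀) * (e₂ - e₀) * (e₂ - e₁)) ^ 2 := by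
  have : discriminant κ τ = -4 * (τ - 3 * κ ^ 2) ^ 3 - 27 * (2 * κ ^ 3 + 2 * κ * τ - 1) ^ 2 := by
    rw [discriminant]; ring
  rw [this, ← h2, ← h3]
  obtain rfl : e₂ = -e₀ - e₁ := by linarith
  ring

/-! ### The parameters of the symmetrical configurations -/

/-- The quantity `X` such that `mu r ρ = N / (N - 2 X ^ (2 / 3))`. -/
def cubeBase (r ρ : ℝ) : ℝ := (2 + 3 * r - 3 * r ^ 2 - 2 * r ^ 3) * (-4 * ρ + ρ ^ 5)

/-- The numerator `N` of `mu`. -/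
def muNum (r ρ : ℝ) : ℝ := 4 + 8 * r + 12 * ρ ^ 2 + (1 + 2 * r) * ρ ^ 4

theorem sq_lt_two_of_mem {r ρ : ℝ} (h : (r, ρ) ∈ paramDomain) : ρ ^ 2 < 2 := by
  have h2 : ρ < Real.sqrt 2 := h.2.1.2
  have h0 : 0 < ρ := h.2.1.1
  nlinarith [Real.sq_sqrt (show (0 : ℝ) ≤ 2 by norm_num), Real.sqrt_nonneg 2]

/-- The upper bound for `ρ` in `paramDomain` is the smaller positive root of `muNum`. -/
theorem muNum_neg {r ρ : ℝ} (h : (r, ρ) ∈ paramDomain) : muNum r ρ < 0 := by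
  obtain ⟨⟨h1, h2⟩, ⟨h0, -⟩, h3⟩ := h
  simp only at h1 h2 h0 h3
  have hs : 0 ≤ 2 - r - r ^ 2 := by nlinarith
  set q := Real.sqrt (2 - r - r ^ 2) with hq
  have hq2 : q ^ 2 = 2 - r - r ^ 2 := Real.sq_sqrt hs
  have hq0 : 0 ≤ q := Real.sqrt_nonneg _
  have hlt : ρ ^ 2 < 2 * (-3 + 2 * q) / (1 + 2 * r) := (Real.lt_sqrt h0.le).1 h3
  have hm : 1 + 2 * r < 0 := by linarith
  rw [lt_div_iff_of_neg hm] at hlt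
  -- multiplied by `1 + 2 r`, the numerator splits into the factors at its two roots
  have hfac : (1 + 2 * r) * muNum r ρ =
      (ρ ^ 2 * (1 + 2 * r) - 2 * (-3 + 2 * q)) * (ρ ^ 2 * (1 + 2 * r) - 2 * (-3 - 2 * q)) := by
    rw [muNum]; linear_combination 16 * hq2
  have hpos : 0 < (1 + 2 * r) * muNum r ρ := by
    rw [hfac]; apply mul_pos <;> linarith
  by_contra hc
  nlinarith

theorem cubeBase_pos {r ρ : ℝ} (h : (r, ρ) ∈ paramDomain) : 0 < cubeBase r ρ := by
  have hx := sq_lt_two_of_mem h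
  obtain ⟨⟨h1, h2⟩, ⟨h0, -⟩, -⟩ := h
  simp only at h1 h2 h0
  have : cubeBase r ρ =
      ((1 - r) * (2 + r) * (-1 - 2 * r)) * (ρ * ((2 - ρ ^ 2) * (2 + ρ ^ 2))) := by
    rw [cubeBase]; ring
  rw [this]
  have : 0 < 1 - r := by linarith
  have : 0 < 2 + r := by linarith
  have : 0 < -1 - 2 * r := by linarith
  have : 0 < 2 - ρ ^ 2 := by linarith
  positivity

/-- In terms of a real cube root `c` of `cubeBase`, the largest exponent is a rational function. -/
theorem exists_cube_root {r ρ : ℝ} (h : (r, ρ) ∈ paramDomain) :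
    ∃ c : ℝ, 0 < c ∧ c ^ 3 = cubeBase r ρ ∧ ev₃ r ρ = -muNum r ρ / (2 * c ^ 2) := by
  have hX := cubeBase_pos h
  have hN := muNum_neg h
  refine ⟨cubeBase r ρ ^ (1 / 3 : ℝ), Real.rpow_pos_of_pos hX _, ?_, ?_⟩
  · rw [← Real.rpow_natCast, ← Real.rpow_mul hX.le]; norm_num
  · have hc : cubeBase r ρ ^ (2 / 3 : ℝ) = (cubeBase r ρ ^ (1 / 3 : ℝ)) ^ 2 := by
      rw [← Real.rpow_natCast, ← Real.rpow_mul hX.le]; norm_num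
    have hc0 : 0 < cubeBase r ρ ^ (1 / 3 : ℝ) := Real.rpow_pos_of_pos hX _
    have hmu : mu r ρ = muNum r ρ / (muNum r ρ - 2 * (cubeBase r ρ ^ (1 / 3 : ℝ)) ^ 2) := by
      rw [← hc]; rfl
    rw [ev₃, hmu]
    set c := cubeBase r ρ ^ (1 / 3 : ℝ)
    have hd : muNum r ρ - 2 * c ^ 2 ≠ 0 := by nlinarith [sq_nonneg c]
    rw [one_sub_div hd, div_div_div_cancel_right₀ hd]
    rw [show muNum r ρ - 2 * c ^ 2 - muNum r ρ = -(2 * c ^ 2) by ring, div_neg, neg_div]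

theorem ev₃_pos {r ρ : ℝ} (h : (r, ρ) ∈ paramDomain) : 0 < ev₃ r ρ := by
  obtain ⟨c, hc, -, he⟩ := exists_cube_root h
  have := muNum_neg h
  rw [he]
  have : 0 < -muNum r ρ := by linarith
  positivity

/-- The bending is positive and large compared with the second symmetric function
`-a² (1 + r + r²)` of the exponents. The bending is `-a Q / (2 N)` with `Q` the bracket below,
and `Q` exceeds `-N`. -/
theorem bending_bound {r ρ : ℝ} (h : (r, ρ) ∈ paramDomain) :
    0 < -(1 + 2 * r) * (ρ ^ 4 + 4) + (4 - 8 * r - 8 * r ^ 2) * ρ ^ 2 ∧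
      muNum r ρ ^ 2 * (1 + r + r ^ 2) <
        3 * (-(1 + 2 * r) * (ρ ^ 4 + 4) + (4 - 8 * r - 8 * r ^ 2) * ρ ^ 2) ^ 2 := by
  have hN := muNum_neg h
  obtain ⟨⟨h1, h2⟩, ⟨h0, -⟩, -⟩ := h
  simp only at h1 h2 h0
  have hr : 0 < 16 - 8 * r - 8 * r ^ 2 := by nlinarith
  have hQ : -(1 + 2 * r) * (ρ ^ 4 + 4) + (4 - 8 * r - 8 * r ^ 2) * ρ ^ 2 =
      -muNum r ρ + (16 - 8 * r - 8 * r ^ 2) * ρ ^ 2 := by rw [muNum]; ring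
  have hpos : 0 < (16 - 8 * r - 8 * r ^ 2) * ρ ^ 2 := by positivity
  rw [hQ]
  refine ⟨by linarith, ?_⟩
  have h3 : 1 + r + r ^ 2 < 3 := by nlinarith
  have : muNum r ρ ^ 2 ≤ (-muNum r ρ + (16 - 8 * r - 8 * r ^ 2) * ρ ^ 2) ^ 2 := by nlinarith
  nlinarith [sq_pos_of_neg hN]

/-! ### The unit sphere and the normalized linear isotopy -/

theorem S3.ext_complex {x y : S3} (h₁ : x.z₁ = y.z₁) (h₂ : x.z₂ = y.z₂) : x = y := by
  apply Subtype.ext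
  ext j
  fin_cases j
  · exact congrArg Complex.re h₁
  · exact congrArg Complex.im h₁
  · exact congrArg Complex.re h₂
  · exact congrArg Complex.im h₂

theorem S3.exists_of_complex (z w : ℂ) (h : ‖z‖ ^ 2 + ‖w‖ ^ 2 = 1) :
    ∃ x : S3, x.z₁ = z ∧ x.z₂ = w := by
  refine ⟨⟨!₂[z.re, z.im, w.re, w.im], ?_⟩, rfl, rfl⟩
  rw [mem_sphere_zero_iff_norm, EuclideanSpace.norm_eq, Real.sqrt_eq_one]
  rw [Complex.sq_norm, Complex.sq_norm, Complex.normSq_apply, Complex.normSq_apply] at h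
  simp [Fin.sum_univ_four]
  linarith

theorem sphereMap_injective : Function.Injective sphereMap := by
  intro x y h
  obtain ⟨a, ha⟩ := (Projectivization.mk_eq_mk_iff' ℂ _ _ _ _).1 h
  have h0 := congrFun ha 0
  have h1 := congrFun ha 1
  have h2 := congrFun ha 2
  simp [sphereVec] at h0 h1 h2
  -- the first and third coordinates satisfy `v₁ - i v₃ = 1`, which fixes the scalar
  have ha1 : a = 1 := by
    linear_combination h0 - Complex.I * h2 +
      (a * (1 - y.z₁) / 2 - (1 - x.z₁) / 2) * Complex.I_sq
  subst ha1
  apply S3.ext_complex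
  · linear_combination -2 * h0
  · rw [one_mul, div_left_inj' (by simp), mul_right_inj' Complex.I_ne_zero] at h1
    exact h1.symm

/-- The linear map `(z₁, z₂) ↦ (exp u * z₁, exp (i φ) * z₂)` of `ℂ² = ℝ⁴`. -/
noncomputable def stretch (u φ : ℝ) (x : EuclideanSpace ℝ (Fin 4)) : EuclideanSpace ℝ (Fin 4) :=
  !₂[Real.exp u * x 0, Real.exp u * x 1, Real.cos φ * x 2 - Real.sin φ * x 3,
    Real.sin φ * x 2 + Real.cos φ * x 3]

theorem stretch_smul (u φ k : ℝ) (x : EuclideanSpace ℝ (Fin 4)) :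
    stretch u φ (k • x) = k • stretch u φ x := by
  ext j
  fin_cases j <;> simp [stretch] <;> ring

theorem stretch_neg_stretch (u φ : ℝ) (x : EuclideanSpace ℝ (Fin 4)) :
    stretch (-u) (-φ) (stretch u φ x) = x := by
  have h : Real.exp (-u) * Real.exp u = 1 := by rw [← Real.exp_add]; simp
  have h' := Real.sin_sq_add_cos_sq φ
  ext j
  fin_cases j <;> simp [stretch]
  · linear_combination x 0 * h
  · linear_combination x 1 * h
  · linear_combination x 2 * h'
  · linear_combination x 3 * h'

theorem stretch_ne_zero (u φ : ℝ) {x : EuclideanSpace ℝ (Fin 4)} (hx : x ≠ 0) :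
    stretch u φ x ≠ 0 := by
  intro h
  apply hx
  rw [← stretch_neg_stretch u φ x, h]
  simpa using stretch_smul (-u) (-φ) 0 0

theorem S3.coe_ne_zero (x : S3) : (x : EuclideanSpace ℝ (Fin 4)) ≠ 0 :=
  ne_zero_of_mem_unit_sphere x

/-- The map of the unit sphere induced by `stretch u φ` on rays. -/
noncomputable def sphereStretch (u φ : ℝ) (x : S3) : S3 :=
  ⟨‖stretch u φ x‖⁻¹ • stretch u φ x, by
    rw [mem_sphere_zero_iff_norm]
    exact norm_smul_inv_norm (𝕜 := ℝ) (stretch_ne_zero u φ x.coe_ne_zero)⟩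

theorem sphereStretch_neg (u φ : ℝ) (x : S3) :
    sphereStretch (-u) (-φ) (sphereStretch u φ x) = x := by
  have h0 := norm_pos_iff.2 (stretch_ne_zero u φ x.coe_ne_zero)
  have hx : ‖(x : EuclideanSpace ℝ (Fin 4))‖ = 1 := mem_sphere_zero_iff_norm.1 x.2
  apply Subtype.ext
  simp only [sphereStretch, stretch_smul, stretch_neg_stretch, norm_smul, hx, smul_smul]
  rw [Real.norm_of_nonneg (by positivity), mul_one, inv_mul_cancel₀ (by positivity), one_smul]

theorem contDiff_stretch {u φ : ℝ → ℝ} (hu : ContDiff ℝ ∞ u) (hφ : ContDiff ℝ ∞ φ) :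
    ContDiff ℝ ∞ (fun y : ℝ × EuclideanSpace ℝ (Fin 4) => stretch (u y.1) (φ y.1) y.2) := by
  have hco : ∀ j, ContDiff ℝ ∞ (fun y : ℝ × EuclideanSpace ℝ (Fin 4) => y.2 j) :=
    fun j => (EuclideanSpace.proj (𝕜 := ℝ) j).contDiff.comp contDiff_snd
  have h0 := hco 0
  have h1 := hco 1
  have h2 := hco 2
  have h3 := hco 3
  have he : ContDiff ℝ ∞ (fun y : ℝ × EuclideanSpace ℝ (Fin 4) => Real.exp (u y.1)) :=
    Real.contDiff_exp.comp (hu.comp contDiff_fst)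
  have hs : ContDiff ℝ ∞ (fun y : ℝ × EuclideanSpace ℝ (Fin 4) => Real.sin (φ y.1)) :=
    Real.contDiff_sin.comp (hφ.comp contDiff_fst)
  have hc : ContDiff ℝ ∞ (fun y : ℝ × EuclideanSpace ℝ (Fin 4) => Real.cos (φ y.1)) :=
    Real.contDiff_cos.comp (hφ.comp contDiff_fst)
  rw [contDiff_euclidean]
  intro j
  fin_cases j
  · exact he.mul h0
  · exact he.mul h1
  · exact (hc.mul h2).sub (hs.mul h3)
  · exact (hs.mul h2).add (hc.mul h3)

theorem S3.contMDiff_coe :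
    ContMDiff (𝓡 3) 𝓘(ℝ, EuclideanSpace ℝ (Fin 4)) ∞
      (fun x : S3 => (x : EuclideanSpace ℝ (Fin 4))) := by
  have : Fact (Module.finrank ℝ (EuclideanSpace ℝ (Fin 4)) = 3 + 1) := ⟨finrank_euclideanSpace_fin⟩
  exact contMDiff_coe_sphere

theorem S3.contMDiff_of_coe {f : ℝ × S3 → S3}
    (hf : ContMDiff (𝓘(ℝ, ℝ).prod (𝓡 3)) 𝓘(ℝ, EuclideanSpace ℝ (Fin 4)) ∞
      (fun x => (f x : EuclideanSpace ℝ (Fin 4)))) :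
    ContMDiff (𝓘(ℝ, ℝ).prod (𝓡 3)) (𝓡 3) ∞ f := by
  have : Fact (Module.finrank ℝ (EuclideanSpace ℝ (Fin 4)) = 3 + 1) := ⟨finrank_euclideanSpace_fin⟩
  exact hf.codRestrict_sphere fun x => (f x).2

theorem contDiffAt_normalize_stretch {u φ : ℝ → ℝ} (hu : ContDiff ℝ ∞ u) (hφ : ContDiff ℝ ∞ φ)
    {y : ℝ × EuclideanSpace ℝ (Fin 4)} (hy : y.2 ≠ 0) :
    ContDiffAt ℝ ∞ (fun y : ℝ × EuclideanSpace ℝ (Fin 4) =>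
      ‖stretch (u y.1) (φ y.1) y.2‖⁻¹ • stretch (u y.1) (φ y.1) y.2) y := by
  have hs := (contDiff_stretch hu hφ).contDiffAt (x := y)
  have hne := stretch_ne_zero (u y.1) (φ y.1) hy
  exact ((hs.norm ℝ hne).inv (norm_ne_zero_iff.2 hne)).smul hs

theorem contMDiff_prod_coe :
    ContMDiff (𝓘(ℝ, ℝ).prod (𝓡 3)) 𝓘(ℝ, ℝ × EuclideanSpace ℝ (Fin 4)) ∞
      (fun x : ℝ × S3 => (x.1, (x.2 : EuclideanSpace ℝ (Fin 4)))) :=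
  contMDiff_fst.prodMk_space (S3.contMDiff_coe.comp contMDiff_snd)

theorem contMDiff_coe_sphereStretch {u φ : ℝ → ℝ} (hu : ContDiff ℝ ∞ u) (hφ : ContDiff ℝ ∞ φ) :
    ContMDiff (𝓘(ℝ, ℝ).prod (𝓡 3)) 𝓘(ℝ, EuclideanSpace ℝ (Fin 4)) ∞
      (fun x : ℝ × S3 =>
        (sphereStretch (u x.1) (φ x.1) x.2 : EuclideanSpace ℝ (Fin 4))) := by
  intro x
  have h := (contDiffAt_normalize_stretch hu hφ (y := (x.1, x.2)) x.2.coe_ne_zero).contMDiffAt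
  have hc := ContMDiffAt.comp x h (contMDiff_prod_coe x)
  exact hc

theorem contMDiff_sphereStretch {u φ : ℝ → ℝ} (hu : ContDiff ℝ ∞ u) (hφ : ContDiff ℝ ∞ φ) :
    ContMDiff (𝓘(ℝ, ℝ).prod (𝓡 3)) (𝓡 3) ∞
      (fun x : ℝ × S3 => sphereStretch (u x.1) (φ x.1) x.2) :=
  S3.contMDiff_of_coe (contMDiff_coe_sphereStretch hu hφ)

theorem contMDiff_sphereStretch_const (u φ : ℝ) :
    ContMDiff (𝓡 3) (𝓡 3) ∞ (sphereStretch u φ) := by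
  have h := contMDiff_sphereStretch (contDiff_const (c := u)) (contDiff_const (c := φ))
  have hc : ContMDiff (𝓡 3) (𝓘(ℝ, ℝ).prod (𝓡 3)) ∞ (fun x : S3 => ((0 : ℝ), x)) :=
    ContMDiff.prodMk contMDiff_const contMDiff_id
  have := h.comp hc
  exact this

/-- `sphereStretch u φ` as a diffeomorphism. -/
noncomputable def sphereStretchDiffeo (u φ : ℝ) : S3 ≃ₘ^∞⟮𝓡 3, 𝓡 3⟯ S3 where
  toFun := sphereStretch u φ
  invFun := sphereStretch (-u) (-φ)
  left_inv := sphereStretch_neg u φ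
  right_inv x := by simpa using sphereStretch_neg (-u) (-φ) x
  contMDiff_toFun := contMDiff_sphereStretch_const u φ
  contMDiff_invFun := contMDiff_sphereStretch_const (-u) (-φ)

theorem sphereStretch_zero (x : S3) : sphereStretch 0 0 x = x := by
  have hx : ‖(x : EuclideanSpace ℝ (Fin 4))‖ = 1 := mem_sphere_zero_iff_norm.1 x.2
  have hs : stretch 0 0 (x : EuclideanSpace ℝ (Fin 4)) = x := by
    ext j
    fin_cases j <;> simp [stretch]
  apply Subtype.ext
  simp [sphereStretch, hs, hx]

theorem sphereStretch_coords (u φ : ℝ) (x : S3) :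
    (sphereStretch u φ x).z₁ = (‖stretch u φ x‖⁻¹ : ℝ) * (Real.exp u * x.z₁) ∧
      (sphereStretch u φ x).z₂ =
        (‖stretch u φ x‖⁻¹ : ℝ) * (Complex.exp (φ * Complex.I) * x.z₂) := by
  rw [Complex.exp_mul_I, ← Complex.ofReal_cos, ← Complex.ofReal_sin]
  -- an abstract norm keeps `simp` from cancelling it
  have h : ∀ k : ℝ, ‖stretch u φ x‖⁻¹ = k →
      (sphereStretch u φ x).z₁ = (k : ℂ) * (Real.exp u * x.z₁) ∧ (sphereStretch u φ x).z₂ =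
        (k : ℂ) * ((Real.cos φ + Real.sin φ * Complex.I : ℂ) * x.z₂) := by
    intro k hk
    have hx : ∀ j, (sphereStretch u φ x).1 j = k * stretch u φ x j := by
      intro j; rw [← hk]; rfl
    constructor <;> apply Complex.ext <;>
      simp only [S3.z₁, S3.z₂, hx, Complex.mul_re,
        Complex.mul_im, Complex.add_re, Complex.add_im, Complex.ofReal_re, Complex.ofReal_im,
        Complex.I_re, Complex.I_im, stretch, PiLp.toLp_apply, Matrix.cons_val_zero,
        Matrix.cons_val_one, Matrix.cons_val] <;>
      ring
  exact h _ rfl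

theorem norm_stretch_sq (u φ : ℝ) (x : S3) :
    ‖stretch u φ x‖ ^ 2 = Real.exp u ^ 2 * ‖x.z₁‖ ^ 2 + ‖x.z₂‖ ^ 2 := by
  rw [EuclideanSpace.norm_sq_eq, Complex.sq_norm, Complex.sq_norm, Complex.normSq_apply,
    Complex.normSq_apply]
  simp [Fin.sum_univ_four, stretch, S3.z₁, S3.z₂]
  linear_combination (x.1 2 ^ 2 + x.1 3 ^ 2) * Real.sin_sq_add_cos_sq φ

/-- A linear torus knot on any torus `|z₁| = A`, `|z₂| = B` with the second coordinate turned by a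
right angle is ambient isotopic to the standard one: the maps induced on rays by the linear maps
`(z₁, z₂) ↦ ((B / A) ^ σ z₁, exp (i π σ / 2) z₂)` form the isotopy. -/
theorem ambientIsotopic_standardTorusKnot {A B : ℝ} (hA : 0 < A) (hB : 0 < B)
    (hAB : A ^ 2 + B ^ 2 = 1) (p q : ℤ) :
    AmbientIsotopic {x : S3 | ∃ t : ℝ, x.z₁ = A * Complex.exp (Complex.I * q * t) ∧
      x.z₂ = -Complex.I * B * Complex.exp (Complex.I * p * t)} (standardTorusKnot p q) := by
  refine ⟨fun σ => sphereStretchDiffeo (σ * Real.log (B / A)) (σ * (Real.pi / 2)),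
    ?_, fun x => ?_, ?_⟩
  · exact contMDiff_sphereStretch (u := fun σ => σ * Real.log (B / A))
      (φ := fun σ => σ * (Real.pi / 2)) (by fun_prop) (by fun_prop)
  · change sphereStretch (0 * _) (0 * _) x = x
    rw [zero_mul, zero_mul, sphereStretch_zero]
  have hexp : Real.exp (Real.log (B / A)) = B / A := Real.exp_log (by positivity)
  have hA' : (A : ℂ) ≠ 0 := by exact_mod_cast hA.ne'
  have hB' : (B : ℂ) ≠ 0 := by exact_mod_cast hB.ne'
  have h2 : ((Real.sqrt 2 : ℝ) : ℂ) ≠ 0 := by simp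
  have hu : ∀ (n : ℤ) (t : ℝ), ‖Complex.exp (Complex.I * n * t)‖ = 1 := fun n t => by
    rw [Complex.norm_exp]; simp
  have key : ∀ (x : S3) (t : ℝ), x.z₁ = A * Complex.exp (Complex.I * q * t) →
      x.z₂ = -Complex.I * B * Complex.exp (Complex.I * p * t) →
      (sphereStretch (1 * Real.log (B / A)) (1 * (Real.pi / 2)) x).z₁ =
        Complex.exp (Complex.I * q * t) / (Real.sqrt 2 : ℂ) ∧
      (sphereStretch (1 * Real.log (B / A)) (1 * (Real.pi / 2)) x).z₂ =
        Complex.exp (Complex.I * p * t) / (Real.sqrt 2 : ℂ) := by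
    intro x t hx₁ hx₂
    have hn : ‖stretch (1 * Real.log (B / A)) (1 * (Real.pi / 2)) x‖ = Real.sqrt 2 * B := by
      rw [← sq_eq_sq₀ (norm_nonneg _) (by positivity), norm_stretch_sq, hx₁, hx₂]
      simp only [one_mul, hexp, norm_mul, hu _ t, norm_neg, Complex.norm_I, Complex.norm_real,
        Real.norm_of_nonneg hA.le, Real.norm_of_nonneg hB.le]
      rw [mul_pow (Real.sqrt 2), Real.sq_sqrt (by norm_num)]
      field_simp
      ring
    have hrot : Complex.exp (((1 * (Real.pi / 2) : ℝ) : ℂ) * Complex.I) = Complex.I := by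
      rw [one_mul]; push_cast; exact Complex.exp_pi_div_two_mul_I
    obtain ⟨h₁, h₂⟩ := sphereStretch_coords (1 * Real.log (B / A)) (1 * (Real.pi / 2)) x
    rw [h₁, h₂, hn, hx₁, hx₂, hrot, one_mul, hexp]
    push_cast
    constructor
    · field_simp
    · field_simp
      linear_combination (-1 : ℂ) * Complex.I_sq
  ext y
  constructor
  · rintro ⟨x, ⟨t, hx₁, hx₂⟩, rfl⟩
    exact ⟨t, key x t hx₁ hx₂⟩
  · rintro ⟨t, hy₁, hy₂⟩
    obtain ⟨x, hx₁, hx₂⟩ := S3.exists_of_complex (A * Complex.exp (Complex.I * q * t))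
      (-Complex.I * B * Complex.exp (Complex.I * p * t)) (by
        simp only [norm_mul, hu _ t, norm_neg, Complex.norm_I, Complex.norm_real,
          Real.norm_of_nonneg hA.le, Real.norm_of_nonneg hB.le]
        linarith)
    obtain ⟨h₁, h₂⟩ := key x t hx₁ hx₂
    exact ⟨x, ⟨t, hx₁, hx₂⟩, S3.ext_complex (h₁.trans hy₁.symm) (h₂.trans hy₂.symm)⟩

/-! ### The Wilczynski lift of a symmetrical configuration -/

theorem symmConfig_eq_mk (r ρ s : ℝ) (v : C21) (hv : v ≠ 0) (k : ℂ)
    (h : v = k • orbitCurve (baseCoord ρ) (exponents r ρ) s) :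
    symmConfig r ρ s = Projectivization.mk ℂ v hv := by
  symm
  rw [symmConfig, Projectivization.mk_eq_mk_iff']
  exact ⟨k, by rw [oneParam_mulVec, h]⟩

/-- The signed squared moduli of the coordinates of `l • basePoint ρ` in the pseudo-unitary
basis. -/
noncomputable def weight (l ρ : ℝ) : Fin 3 → ℝ :=
  ![-(l ^ 2 * (2 + ρ ^ 2) ^ 2 / 8), l ^ 2 * ρ ^ 2, l ^ 2 * (2 - ρ ^ 2) ^ 2 / 8]

theorem diagForm_baseCoord (l ρ : ℝ) (u v : C21) :
    diagForm (fun j => u j * ((l : ℂ) • baseCoord ρ) j) (fun j => v j * ((l : ℂ) • baseCoord ρ) j) =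
      ∑ j, star (u j) * v j * weight l ρ j := by
  have h0 := sqrt_two_ne_zero
  have h2 := sqrt_two_sq
  simp only [diagForm, weight, baseCoord, Fin.sum_univ_three, Pi.smul_apply, smul_eq_mul,
    Matrix.cons_val_zero, Matrix.cons_val_one, Matrix.cons_val, Complex.star_def, map_mul, map_div₀,
    map_add, map_sub, map_neg, map_pow, Complex.conj_ofReal, Complex.conj_I, map_ofNat]
  push_cast
  have h8 : ((2 : ℂ) * (Real.sqrt 2 : ℂ)) * (2 * (Real.sqrt 2 : ℂ)) = 8 := by
    linear_combination 4 * h2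
  simp only [div_eq_mul_inv]
  have hi : ((2 : ℂ) * (Real.sqrt 2 : ℂ))⁻¹ * (2 * (Real.sqrt 2 : ℂ))⁻¹ = 8⁻¹ := by
    rw [← mul_inv, h8]
  linear_combination (-((starRingEnd ℂ) (u 0) * v 0 * l ^ 2 * (2 + ρ ^ 2) ^ 2) +
    (starRingEnd ℂ) (u 2) * v 2 * l ^ 2 * (2 - ρ ^ 2) ^ 2) * hi -
    ((starRingEnd ℂ) (u 2) * v 2 * l ^ 2 * (2 - ρ ^ 2) ^ 2) *
      ((2 : ℂ) * (Real.sqrt 2 : ℂ))⁻¹ ^ 2 * Complex.I_sq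

theorem exponents_sum (r ρ : ℝ) :
    exponents r ρ 0 + exponents r ρ 1 + exponents r ρ 2 = 0 := by
  simp [exponents, ev₁, ev₂, ev₃]; ring

/-- The lift `l • U exp (s D) U⁻¹ (basePoint ρ)` of the curve; a suitable real `l` makes it a
Wilczynski lift. -/
noncomputable def liftCurve (l r ρ : ℝ) : ℝ → C21 :=
  orbitCurve ((l : ℂ) • baseCoord ρ) (exponents r ρ)

theorem wronskian_liftCurve (l r ρ s : ℝ) :
    wronskian (liftCurve l r ρ) s = (l ^ 3 * ev₃ r ρ ^ 3 * cubeBase r ρ / 8 : ℝ) := by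
  rw [liftCurve, wronskian_orbitCurve _ _ (exponents_sum r ρ)]
  have h1 : ev₁ r ρ = r * ev₃ r ρ := rfl
  have h2 : ev₂ r ρ = -(1 + r) * ev₃ r ρ := rfl
  have h0 := sqrt_two_ne_zero
  simp only [exponents, baseCoord, Pi.smul_apply, smul_eq_mul, Matrix.cons_val_zero,
    Matrix.cons_val_one, Matrix.cons_val, h1, h2, cubeBase]
  push_cast
  field_simp
  rw [sqrt_two_sq, Complex.I_sq]
  ring

/-- The scale `4 c / N`, with `c` a cube root of `cubeBase`, makes the Wronskian and the strain
density of `liftCurve` equal to `-1` and `1`. -/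
theorem exists_scale {r ρ : ℝ} (h : (r, ρ) ∈ paramDomain) :
    ∃ l : ℝ, l ^ 3 * ev₃ r ρ ^ 3 * cubeBase r ρ = -8 ∧ l ^ 2 * ev₃ r ρ * muNum r ρ = -8 := by
  obtain ⟨c, hc, hcX, he⟩ := exists_cube_root h
  have hN := (muNum_neg h).ne
  refine ⟨4 * c / muNum r ρ, ?_, ?_⟩
  · rw [he, ← hcX]; field_simp; norm_num
  · rw [he]; field_simp; norm_num

theorem isSmoothLift_liftCurve {l r ρ : ℝ} (hl : l ≠ 0) :
    IsSmoothLift (liftCurve l r ρ) (symmConfig r ρ) := by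
  refine ⟨contDiff_orbitCurve _ _, fun t => ⟨?_, ?_⟩⟩
  · rw [liftCurve, herm_orbitCurve]
    have h := diagForm_baseCoord l ρ 1 1
    simp only [Pi.one_apply, one_mul, star_one] at h
    refine h.trans ?_
    rw [← Complex.ofReal_sum, Fin.sum_univ_three]
    simp only [weight, Matrix.cons_val_zero, Matrix.cons_val_one, Matrix.cons_val]
    norm_cast
    ring
  · have hl' : (l : ℂ) ≠ 0 := by exact_mod_cast hl
    have hs : liftCurve l r ρ t = (l : ℂ) • orbitCurve (baseCoord ρ) (exponents r ρ) t :=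
      orbitCurve_smul _ _ _ _
    have hne : liftCurve l r ρ t ≠ 0 := by
      rw [hs, ← oneParam_mulVec]
      exact smul_ne_zero hl' (oneParam_mulVec_ne_zero r ρ t)
    exact ⟨hne, symmConfig_eq_mk r ρ t _ hne l hs⟩

/-- The Hermitian products of the derivatives of the lift are the moments of the exponents. -/
theorem herm_liftCurve (l r ρ s : ℝ) :
    herm (liftCurve l r ρ s) (deriv (liftCurve l r ρ) s) =
        -Complex.I * (∑ j, weight l ρ j * exponents r ρ j : ℝ) ∧
      herm (deriv (liftCurve l r ρ) s) (deriv (liftCurve l r ρ) s) =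
        (∑ j, weight l ρ j * exponents r ρ j ^ 2 : ℝ) ∧
      herm (deriv (deriv (liftCurve l r ρ)) s) (deriv (liftCurve l r ρ) s) =
        Complex.I * (∑ j, weight l ρ j * exponents r ρ j ^ 3 : ℝ) := by
  set e := exponents r ρ with he
  set w : C21 := (l : ℂ) • baseCoord ρ with hw
  have hd : deriv (liftCurve l r ρ) = orbitCurve (derivCoeff w e) e := deriv_orbitCurve _ _
  rw [hd, deriv_orbitCurve, liftCurve, ← he, ← hw, herm_orbitCurve, herm_orbitCurve,
    herm_orbitCurve]
  have h0 : w = fun j => (1 : C21) j * w j := by ext j; simp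
  have h2 : derivCoeff (derivCoeff w e) e = fun j => -(e j : ℂ) ^ 2 * w j := by
    ext j
    simp only [derivCoeff]
    linear_combination (e j : ℂ) ^ 2 * w j * Complex.I_sq
  have h1 : derivCoeff w e = fun j => (-Complex.I * e j) * w j := rfl
  rw [h2, h1]
  refine ⟨?_, ?_, ?_⟩
  · nth_rw 1 [h0]
    rw [hw, diagForm_baseCoord l ρ 1 (fun j => -Complex.I * e j)]
    push_cast
    rw [Finset.mul_sum]
    refine Finset.sum_congr rfl fun j _ => ?_
    simp only [Pi.one_apply, star_one]
    ring
  · rw [hw, diagForm_baseCoord l ρ (fun j => -Complex.I * e j) (fun j => -Complex.I * e j)]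
    push_cast
    refine Finset.sum_congr rfl fun j _ => ?_
    simp only [star_mul', star_neg, Complex.star_def, Complex.conj_I, Complex.conj_ofReal]
    linear_combination (-(e j : ℂ) ^ 2 * weight l ρ j) * Complex.I_sq
  · rw [hw, diagForm_baseCoord l ρ (fun j => -(e j : ℂ) ^ 2) (fun j => -Complex.I * e j)]
    push_cast
    rw [Finset.mul_sum]
    refine Finset.sum_congr rfl fun j _ => ?_
    simp only [star_neg, star_pow, Complex.star_def, Complex.conj_ofReal]
    ring

theorem ev₁_lt_ev₂ {r ρ : ℝ} (h : (r, ρ) ∈ paramDomain) : ev₁ r ρ < ev₂ r ρ :=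
  mul_lt_mul_of_pos_right (by linarith [h.1.2]) (ev₃_pos h)

theorem ev₂_lt_ev₃ {r ρ : ℝ} (h : (r, ρ) ∈ paramDomain) : ev₂ r ρ < ev₃ r ρ := by
  have h1 : -2 < r := h.1.1
  calc ev₂ r ρ = -(1 + r) * ev₃ r ρ := rfl
    _ < 1 * ev₃ r ρ := mul_lt_mul_of_pos_right (by linarith) (ev₃_pos h)
    _ = ev₃ r ρ := one_mul _

/-- The moments of the exponents with respect to the weights. -/
noncomputable def moment (l r ρ : ℝ) (n : ℕ) : ℝ := ∑ j, weight l ρ j * exponents r ρ j ^ n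

theorem moment_eq (l r ρ : ℝ) (n : ℕ) : moment l r ρ n =
    weight l ρ 0 * exponents r ρ 0 ^ n + weight l ρ 1 * exponents r ρ 1 ^ n +
      weight l ρ 2 * exponents r ρ 2 ^ n :=
  Fin.sum_univ_three _

theorem weight_sum (l ρ : ℝ) : weight l ρ 0 + weight l ρ 1 + weight l ρ 2 = 0 := by
  simp only [weight, Matrix.cons_val_zero, Matrix.cons_val_one, Matrix.cons_val]; ring

theorem moment_one (l r ρ : ℝ) : moment l r ρ 1 = l ^ 2 * ev₃ r ρ * muNum r ρ / 8 := by
  have h1 : ev₁ r ρ = r * ev₃ r ρ := rfl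
  have h2 : ev₂ r ρ = -(1 + r) * ev₃ r ρ := rfl
  rw [moment_eq]
  simp only [weight, exponents, Matrix.cons_val_zero, Matrix.cons_val_one, Matrix.cons_val, h1,
    h2, muNum]
  ring

theorem moment_two (l r ρ : ℝ) : moment l r ρ 2 = l ^ 2 * ev₃ r ρ ^ 2 *
    (-(1 + 2 * r) * (ρ ^ 4 + 4) + (4 - 8 * r - 8 * r ^ 2) * ρ ^ 2) / 8 := by
  have h1 : ev₁ r ρ = r * ev₃ r ρ := rfl
  have h2 : ev₂ r ρ = -(1 + r) * ev₃ r ρ := rfl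
  rw [moment_eq]
  simp only [weight, exponents, Matrix.cons_val_zero, Matrix.cons_val_one, Matrix.cons_val, h1, h2]
  ring

theorem weight_mul_vandermonde_sq (l r ρ : ℝ) : weight l ρ 0 * weight l ρ 1 * weight l ρ 2 *
    ((exponents r ρ 1 - exponents r ρ 0) * (exponents r ρ 2 - exponents r ρ 0) *
      (exponents r ρ 2 - exponents r ρ 1)) ^ 2 =
        -(l ^ 3 * ev₃ r ρ ^ 3 * cubeBase r ρ / 8) ^ 2 := by
  have h1 : ev₁ r ρ = r * ev₃ r ρ := rfl
  have h2 : ev₂ r ρ = -(1 + r) * ev₃ r ρ := rfl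
  simp only [weight, exponents, Matrix.cons_val_zero, Matrix.cons_val_one, Matrix.cons_val, h1,
    h2, cubeBase]
  ring

/-- The symmetric functions of the eigenvalues `e₁, e₂, e₃` of the Hamiltonian whose bending and
twist are read off from the lift. -/
theorem symmetric_functions_ev {l r ρ κ τ : ℝ}
    (hlX : l ^ 3 * ev₃ r ρ ^ 3 * cubeBase r ρ = -8) (hlN : l ^ 2 * ev₃ r ρ * muNum r ρ = -8)
    (hκ : κ = 1 / 2 * moment l r ρ 2) (hτ : τ = moment l r ρ 3 + 3 * κ ^ 2) :
    ev₁ r ρ * ev₂ r ρ + ev₁ r ρ * ev₃ r ρ + ev₂ r ρ * ev₃ r ρ = τ - 3 * κ ^ 2 ∧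
      ev₁ r ρ * ev₂ r ρ * ev₃ r ρ = 2 * κ ^ 3 + 2 * κ * τ - 1 := by
  have hM1 : moment l r ρ 1 = -1 := by rw [moment_one, hlN]; norm_num
  obtain ⟨hσ₂, hσ₃⟩ := symmetric_functions_of_moments (κ := κ) (τ := τ) (exponents_sum r ρ)
    (weight_sum l ρ) (by rw [← hM1, moment_eq]; ring)
    (by rw [weight_mul_vandermonde_sq, hlX]; norm_num) (by rw [hκ, moment_eq])
    (by rw [hτ, moment_eq])
  rw [← hσ₂, ← hσ₃]
  simp only [exponents, Matrix.cons_val_zero, Matrix.cons_val_one, Matrix.cons_val]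
  constructor <;> ring

theorem ev_sum (r ρ : ℝ) : ev₁ r ρ + ev₂ r ρ + ev₃ r ρ = 0 := by
  rw [ev₁, ev₂, ev₃]; ring

theorem hasSpectralRatio_of_symmetric_functions {r ρ κ τ : ℝ} (h : (r, ρ) ∈ paramDomain)
    (hσ₂ : ev₁ r ρ * ev₂ r ρ + ev₁ r ρ * ev₃ r ρ + ev₂ r ρ * ev₃ r ρ = τ - 3 * κ ^ 2)
    (hσ₃ : ev₁ r ρ * ev₂ r ρ * ev₃ r ρ = 2 * κ ^ 3 + 2 * κ * τ - 1) :
    HasSpectralRatio κ τ r := by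
  have h12 := ev₁_lt_ev₂ h
  have h23 := ev₂_lt_ev₃ h
  refine ⟨?_, ev₁ r ρ, ev₂ r ρ, ev₃ r ρ, h12, h23, spectrum_hamiltonian (ev_sum r ρ) hσ₂ hσ₃, ?_⟩
  · rw [discriminant_eq (ev_sum r ρ) hσ₂ hσ₃]
    exact pow_pos (mul_pos (mul_pos (sub_pos.2 h12) (sub_pos.2 (h12.trans h23)))
      (sub_pos.2 h23)) 2
  · exact (mul_div_cancel_right₀ r (ev₃_pos h).ne').symm

/-- The twist is `3 κ² - a² (1 + r + r²)`, so the condition on the twist is the lower bound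
`12 κ² > a² (1 + r + r²)` for the bending. -/
theorem sqrt_abs_twist_lt {l r ρ κ τ : ℝ} (h : (r, ρ) ∈ paramDomain)
    (hlN : l ^ 2 * ev₃ r ρ * muNum r ρ = -8) (hκ : κ = 1 / 2 * moment l r ρ 2)
    (hσ₂ : ev₁ r ρ * ev₂ r ρ + ev₁ r ρ * ev₃ r ρ + ev₂ r ρ * ev₃ r ρ = τ - 3 * κ ^ 2) :
    Real.sqrt |τ| < 3 * κ := by
  have ha := ev₃_pos h
  have hN := muNum_neg h
  obtain ⟨hQ, hQN⟩ := bending_bound h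
  rw [moment_two] at hκ
  set Q := -(1 + 2 * r) * (ρ ^ 4 + 4) + (4 - 8 * r - 8 * r ^ 2) * ρ ^ 2
  have hl : l ≠ 0 := by rintro rfl; norm_num at hlN
  have hκ0 : 0 < κ := by
    rw [hκ]
    have : 0 < l ^ 2 := by positivity
    positivity
  have hτσ : τ = 3 * κ ^ 2 - ev₃ r ρ ^ 2 * (1 + r + r ^ 2) := by
    have : ev₁ r ρ * ev₂ r ρ + ev₁ r ρ * ev₃ r ρ + ev₂ r ρ * ev₃ r ρ =
        -(ev₃ r ρ ^ 2 * (1 + r + r ^ 2)) := by rw [ev₁, ev₂, ev₃]; ring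
    linarith
  have hκa : ev₃ r ρ ^ 2 * (1 + r + r ^ 2) < 12 * κ ^ 2 := by
    have hκN : κ * muNum r ρ = -(ev₃ r ρ * Q / 2) := by
      rw [hκ]; linear_combination (ev₃ r ρ * Q / 16) * hlN
    have hN2 : 0 < muNum r ρ ^ 2 := sq_pos_of_neg hN
    refine lt_of_mul_lt_mul_right ?_ hN2.le
    calc ev₃ r ρ ^ 2 * (1 + r + r ^ 2) * muNum r ρ ^ 2
        = ev₃ r ρ ^ 2 * (muNum r ρ ^ 2 * (1 + r + r ^ 2)) := by ring
      _ < ev₃ r ρ ^ 2 * (3 * Q ^ 2) := mul_lt_mul_of_pos_left hQN (pow_pos ha 2)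
      _ = 12 * κ ^ 2 * muNum r ρ ^ 2 := by
        linear_combination -12 * (κ * muNum r ρ - ev₃ r ρ * Q / 2) * hκN
  have hpos : 0 < ev₃ r ρ ^ 2 * (1 + r + r ^ 2) :=
    mul_pos (pow_pos ha 2) (by nlinarith [sq_nonneg (r + 1 / 2)])
  rw [Real.sqrt_lt' (by linarith), abs_lt, hτσ]
  have hκ2 : 0 < κ ^ 2 := pow_pos hκ0 2
  constructor <;> linarith [mul_pow 3 κ 2]

/-- The curve is generic transversal and naturally parametrized, with constant bending and twist in
the first class, and the exponents are the eigenvalues of its Hamiltonian. -/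
theorem exists_bending_twist {r ρ : ℝ} (h : (r, ρ) ∈ paramDomain) :
    ∃ κ τ : ℝ, IsGenericTransversal (symmConfig r ρ) ∧
      IsNaturalWith (symmConfig r ρ) (fun _ => κ) (fun _ => τ) ∧
      IsFirstClass κ τ ∧ HasSpectralRatio κ τ r := by
  obtain ⟨l, hlX, hlN⟩ := exists_scale h
  have hl : l ≠ 0 := by rintro rfl; norm_num at hlN
  obtain ⟨κ, hκ⟩ : ∃ κ, κ = 1 / 2 * moment l r ρ 2 := ⟨_, rfl⟩
  obtain ⟨τ, hτ⟩ : ∃ τ, τ = moment l r ρ 3 + 3 * κ ^ 2 := ⟨_, rfl⟩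
  obtain ⟨hσ₂, hσ₃⟩ := symmetric_functions_ev hlX hlN hκ hτ
  have hratio := hasSpectralRatio_of_symmetric_functions h hσ₂ hσ₃
  have hM1 : (∑ j, weight l ρ j * exponents r ρ j : ℝ) = -1 := by
    have : moment l r ρ 1 = -1 := by rw [moment_one, hlN]; norm_num
    simpa only [moment, pow_one] using this
  have hherm := herm_liftCurve l r ρ
  have hΓΓ' : ∀ s, herm (liftCurve l r ρ s) (deriv (liftCurve l r ρ) s) = Complex.I := fun s => by
    rw [(hherm s).1, hM1]; simp
  have hwr : ∀ s, wronskian (liftCurve l r ρ) s = -1 := fun s => by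
    rw [wronskian_liftCurve, hlX]; norm_num
  have hlift : IsSmoothLift (liftCurve l r ρ) (symmConfig r ρ) := isSmoothLift_liftCurve hl
  refine ⟨κ, τ, ⟨liftCurve l r ρ, hlift, fun t => ⟨?_, ?_⟩⟩, ⟨liftCurve l r ρ, ⟨hlift, hwr⟩, ?_, ?_⟩,
    ⟨hratio.1, sqrt_abs_twist_lt h hlN hκ hσ₂⟩, hratio⟩
  · obtain ⟨-, hne, -⟩ := hlift.2 t
    obtain ⟨j, hj⟩ := Function.ne_iff.1 hne
    have hpos : 0 < ∑ i, ‖liftCurve l r ρ t i‖ ^ 2 :=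
      Finset.sum_pos' (fun i _ => sq_nonneg _)
        ⟨j, Finset.mem_univ _, pow_pos (norm_pos_iff.2 hj) 2⟩
    rw [contactForm, hΓΓ']
    simp [hpos]
  · rw [hwr]; norm_num
  · intro s
    rw [strainDensity, hΓΓ', mul_inv_cancel₀ Complex.I_ne_zero]
  · intro s
    obtain ⟨-, hΓ2, hΓ3⟩ := hherm s
    rw [hΓ2, hΓ3]
    refine ⟨?_, ?_⟩
    · rw [hκ, moment]; push_cast; rfl
    · rw [hτ, moment, Complex.I_mul_im, Complex.ofReal_re]

/-! ### Spherical coordinates of a symmetrical configuration -/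

/-- The modulus of the first spherical coordinate along the curve. -/
noncomputable def radius₁ (ρ : ℝ) : ℝ := (2 - ρ ^ 2) / (2 + ρ ^ 2)

/-- The modulus of the second spherical coordinate along the curve. -/
noncomputable def radius₂ (ρ : ℝ) : ℝ := 2 * Real.sqrt 2 * ρ / (2 + ρ ^ 2)

theorem radius_sq_add (ρ : ℝ) : radius₁ ρ ^ 2 + radius₂ ρ ^ 2 = 1 := by
  have h : 0 < 2 + ρ ^ 2 := by positivity
  rw [radius₁, radius₂]
  field_simp
  rw [Real.sq_sqrt (by norm_num)]
  ring

theorem symmConfig_eq_sphereMap (r ρ s : ℝ) (x : S3)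
    (h₁ : x.z₁ = radius₁ ρ * Complex.exp (Complex.I * ((ev₂ r ρ - ev₁ r ρ) * s : ℝ)))
    (h₂ : x.z₂ = -Complex.I * radius₂ ρ * Complex.exp (Complex.I * ((ev₂ r ρ - ev₃ r ρ) * s : ℝ))) :
    sphereMap x = symmConfig r ρ s := by
  have hE₁ : Complex.exp (-Complex.I * ev₁ r ρ * s) = Complex.exp (-Complex.I * ev₂ r ρ * s) *
      Complex.exp (Complex.I * ((ev₂ r ρ - ev₁ r ρ) * s : ℝ)) := by
    rw [← Complex.exp_add]; congr 1; push_cast; ring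
  have hE₃ : Complex.exp (-Complex.I * ev₃ r ρ * s) = Complex.exp (-Complex.I * ev₂ r ρ * s) *
      Complex.exp (Complex.I * ((ev₂ r ρ - ev₃ r ρ) * s : ℝ)) := by
    rw [← Complex.exp_add]; congr 1; push_cast; ring
  have h0 := sqrt_two_ne_zero
  have hρ : (2 : ℂ) + ρ ^ 2 ≠ 0 := by
    have : (2 : ℝ) + ρ ^ 2 ≠ 0 := by positivity
    exact_mod_cast this
  have hE0 := Complex.exp_ne_zero (-Complex.I * ev₂ r ρ * s)
  symm
  refine symmConfig_eq_mk r ρ s _ _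
    (2 / ((2 + ρ ^ 2) * Complex.exp (-Complex.I * ev₂ r ρ * s))) ?_
  rw [sphereVec, h₁, h₂, radius₁, radius₂]
  ext j
  fin_cases j <;>
    simp only [orbitCurve, basisU, baseCoord, exponents, Matrix.mulVec, dotProduct,
      Fin.sum_univ_three, Matrix.of_apply, Pi.smul_apply, smul_eq_mul, Matrix.cons_val_zero,
      Matrix.cons_val_one, Matrix.cons_val, hE₁, hE₃, Fin.zero_eta, Fin.mk_one, Fin.reduceFinMk] <;>
    push_cast <;> field_simp
  · rw [sqrt_two_sq, Complex.I_sq]; ring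
  · rw [Complex.I_sq]; ring
  · rw [sqrt_two_sq]; ring

theorem exists_sphereMap_eq (r ρ s : ℝ) : ∃ x : S3, sphereMap x = symmConfig r ρ s ∧
    x.z₁ = radius₁ ρ * Complex.exp (Complex.I * ((ev₂ r ρ - ev₁ r ρ) * s : ℝ)) ∧
    x.z₂ = -Complex.I * radius₂ ρ * Complex.exp (Complex.I * ((ev₂ r ρ - ev₃ r ρ) * s : ℝ)) := by
  obtain ⟨x, h₁, h₂⟩ := S3.exists_of_complex
    (radius₁ ρ * Complex.exp (Complex.I * ((ev₂ r ρ - ev₁ r ρ) * s : ℝ)))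
    (-Complex.I * radius₂ ρ * Complex.exp (Complex.I * ((ev₂ r ρ - ev₃ r ρ) * s : ℝ))) (by
      have := radius_sq_add ρ
      simpa only [norm_mul, norm_neg, Complex.norm_I, Complex.norm_exp_I_mul_ofReal,
        Complex.norm_real, Real.norm_eq_abs, sq_abs, one_mul, mul_one] using this)
  exact ⟨x, symmConfig_eq_sphereMap r ρ s x h₁ h₂, h₁, h₂⟩

/-! ### The Heisenberg cyclide -/

theorem torusElement_mulVec_basePoint (r ρ s : ℝ) :
    torusElement (-(2 * ev₂ r ρ + ev₃ r ρ) * s) ((ev₂ r ρ - ev₃ r ρ) * s) *ᵥ basePoint ρ =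
      oneParam r ρ s *ᵥ basePoint ρ := by
  have hσ : (ev₁ r ρ : ℂ) + ev₂ r ρ + ev₃ r ρ = 0 := by exact_mod_cast ev_sum r ρ
  -- the rotation block has the first and third columns of `basisU` as eigenvectors, with
  -- eigenvalues `ε exp (i f) = exp (-i e₂ s)` and `ε exp (-i f) = exp (-i e₁ s)`
  obtain ⟨ε, hε⟩ : ∃ ε, ε = Complex.exp (Complex.I * (ev₃ r ρ * s / 2)) := ⟨_, rfl⟩
  obtain ⟨f, hf⟩ : ∃ f, f = -(2 * ev₂ r ρ + ev₃ r ρ) * s / 2 := ⟨_, rfl⟩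
  have hE₂ : Complex.exp (-Complex.I * ev₂ r ρ * s) = ε * Complex.exp (f * Complex.I) := by
    rw [hε, ← Complex.exp_add, hf]; congr 1; push_cast; ring
  have hE₁ : Complex.exp (-Complex.I * ev₁ r ρ * s) = ε * Complex.exp (-f * Complex.I) := by
    rw [hε, ← Complex.exp_add, hf]; congr 1; push_cast
    linear_combination (-Complex.I * s) * hσ
  have hexp : Complex.exp (-Complex.I / 6 * ((-(2 * ev₂ r ρ + ev₃ r ρ) * s : ℝ) +
      2 * ((ev₂ r ρ - ev₃ r ρ) * s : ℝ))) = ε := by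
    rw [hε]; congr 1; push_cast; ring
  have hexp' : Complex.exp (Complex.I / 3 * ((-(2 * ev₂ r ρ + ev₃ r ρ) * s : ℝ) +
      2 * ((ev₂ r ρ - ev₃ r ρ) * s : ℝ))) = Complex.exp (-Complex.I * ev₃ r ρ * s) := by
    congr 1; push_cast; ring
  have hθ : ((-(2 * ev₂ r ρ + ev₃ r ρ) * s : ℝ) : ℂ) / 2 = f := by rw [hf]; push_cast; rfl
  have h0 := sqrt_two_ne_zero
  rw [oneParam_mulVec, torusElement, hexp, hexp', hθ, Complex.cos, Complex.sin]
  ext j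
  fin_cases j <;>
    simp only [orbitCurve, basisU, baseCoord, basePoint, exponents, Matrix.mulVec, dotProduct,
      Fin.sum_univ_three, Matrix.of_apply, Matrix.cons_val_zero, Matrix.cons_val_one,
      Matrix.cons_val, hE₁, hE₂, Fin.zero_eta, Fin.mk_one, Fin.reduceFinMk] <;>
    field_simp
  · rw [sqrt_two_sq, Complex.I_sq]; ring
  · ring
  · rw [sqrt_two_sq]; ring

theorem range_symmConfig_subset_heisenbergCyclide (r ρ : ℝ) :
    range (symmConfig r ρ) ⊆ heisenbergCyclide ρ := by
  rintro _ ⟨s, rfl⟩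
  have h := torusElement_mulVec_basePoint r ρ s
  refine ⟨_, _, h ▸ oneParam_mulVec_ne_zero r ρ s, ?_⟩
  simp only [symmConfig, h]

/-! ### Closedness and the knot type -/

/-- The frequencies of the two spherical coordinates are coprime integer multiples of a common
frequency. -/
theorem exists_common_frequency (r : ℚ) (ρ : ℝ) (h : ((r : ℝ), ρ) ∈ paramDomain) :
    ∃ p q : ℤ, 0 < p ∧ q < 0 ∧ IsCoprime p q ∧ (p : ℚ) / q = (2 + r) / (1 + 2 * r) ∧
      ∃ b : ℝ, 0 < b ∧ ev₂ r ρ - ev₁ r ρ = -(q * b) ∧ ev₂ r ρ - ev₃ r ρ = -(p * b) := by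
  have hr1 : (-2 : ℝ) < r := h.1.1
  have hr2 : (r : ℝ) < -1 / 2 := h.1.2
  have hr1' : (-2 : ℚ) < r := by exact_mod_cast hr1
  have hr2' : r < -1 / 2 := by
    have : (r : ℝ) < ((-1 / 2 : ℚ) : ℝ) := by push_cast; exact hr2
    exact_mod_cast this
  set t : ℚ := (2 + r) / (1 + 2 * r) with ht
  have ht0 : t < 0 := div_neg_of_pos_of_neg (by linarith) (by linarith)
  have hnum : t.num < 0 := Rat.num_neg.2 ht0
  have hden : (0 : ℤ) < t.den := by exact_mod_cast t.den_pos
  have hpq : ((-t.num : ℤ) : ℚ) / ((-t.den : ℤ) : ℚ) = t := by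
    push_cast
    rw [neg_div_neg_eq, Rat.num_div_den]
  refine ⟨-t.num, -t.den, by omega, by omega, ?_, hpq,
    (2 + r) * ev₃ r ρ / (-t.num : ℤ), ?_, ?_, ?_⟩
  · rw [IsCoprime.neg_neg_iff, Int.isCoprime_iff_nat_coprime]
    simpa using t.reduced
  · have : (0 : ℝ) < (-t.num : ℤ) := by exact_mod_cast neg_pos.2 hnum
    have h2 : (0 : ℝ) < 2 + r := by linarith
    have := ev₃_pos h
    positivity
  · have hn : ((-t.num : ℤ) : ℝ) ≠ 0 := by exact_mod_cast (neg_pos.2 hnum).ne'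
    have hd : ((-t.den : ℤ) : ℝ) ≠ 0 := by exact_mod_cast (neg_neg_of_pos hden).ne
    have hq : (((-t.num : ℤ) : ℚ) : ℝ) / (((-t.den : ℤ) : ℚ) : ℝ) = (2 + r) / (1 + 2 * r) := by
      have := congrArg (Rat.cast : ℚ → ℝ) (hpq.trans ht)
      push_cast at this ⊢
      exact this
    rw [Rat.cast_intCast, Rat.cast_intCast, div_eq_div_iff hd (by linarith)] at hq
    have : ((-t.den : ℤ) : ℝ) * ((2 + r) * ev₃ r ρ / (-t.num : ℤ)) = (1 + 2 * r) * ev₃ r ρ := by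
      field_simp
      linear_combination -ev₃ r ρ * hq
    rw [this, ev₁, ev₂, ev₃]
    ring
  · have hn : ((-t.num : ℤ) : ℝ) ≠ 0 := by exact_mod_cast (neg_pos.2 hnum).ne'
    rw [mul_div_cancel₀ _ hn, ev₂, ev₃]
    ring

/-- Bézout: two exponentials with coprime frequencies determine the one with frequency `1`. -/
theorem exp_eq_exp_of_coprime {p q : ℤ} (hpq : IsCoprime p q) {t t' : ℝ}
    (hp : Complex.exp (Complex.I * p * t) = Complex.exp (Complex.I * p * t'))
    (hq : Complex.exp (Complex.I * q * t) = Complex.exp (Complex.I * q * t')) :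
    Complex.exp (Complex.I * t) = Complex.exp (Complex.I * t') := by
  obtain ⟨u, v, huv⟩ := hpq
  have huv' : (u : ℂ) * p + v * q = 1 := by exact_mod_cast huv
  have key : ∀ x : ℝ, Complex.exp (Complex.I * x) =
      Complex.exp (Complex.I * p * x) ^ u * Complex.exp (Complex.I * q * x) ^ v := fun x => by
    rw [← Complex.exp_int_mul, ← Complex.exp_int_mul, ← Complex.exp_add]
    congr 1
    linear_combination (-Complex.I * x) * huv'
  rw [key, key, hp, hq]

/-- The curve in spherical coordinates, in terms of the common frequency `b`. -/
theorem exists_sphereMap_eq_of_frequency {r ρ b : ℝ} {p q : ℤ}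
    (h₁ : ev₂ r ρ - ev₁ r ρ = -(q * b)) (h₃ : ev₂ r ρ - ev₃ r ρ = -(p * b)) (s : ℝ) :
    ∃ x : S3, sphereMap x = symmConfig r ρ s ∧
      x.z₁ = radius₁ ρ * Complex.exp (Complex.I * q * (-(b * s) : ℝ)) ∧
      x.z₂ = -Complex.I * radius₂ ρ * Complex.exp (Complex.I * p * (-(b * s) : ℝ)) := by
  obtain ⟨x, hx, hx₁, hx₂⟩ := exists_sphereMap_eq r ρ s
  refine ⟨x, hx, ?_, ?_⟩
  · rw [hx₁, h₁]; congr 2; push_cast; ring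
  · rw [hx₂, h₃]; congr 2; push_cast; ring

theorem radius₁_pos {r ρ : ℝ} (h : (r, ρ) ∈ paramDomain) : 0 < radius₁ ρ :=
  div_pos (sub_pos.2 (sq_lt_two_of_mem h)) (by positivity)

theorem radius₂_pos {r ρ : ℝ} (h : (r, ρ) ∈ paramDomain) : 0 < radius₂ ρ := by
  have : 0 < ρ := h.2.1.1
  rw [radius₂]
  positivity

theorem symmConfig_eq_iff {r ρ b : ℝ} {p q : ℤ} (h : (r, ρ) ∈ paramDomain) (hpq : IsCoprime p q)
    (hb : 0 < b) (h₁ : ev₂ r ρ - ev₁ r ρ = -(q * b)) (h₃ : ev₂ r ρ - ev₃ r ρ = -(p * b))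
    (s s' : ℝ) :
    symmConfig r ρ s = symmConfig r ρ s' ↔ ∃ n : ℤ, s = s' + n * (2 * Real.pi / b) := by
  obtain ⟨x, hx, hx₁, hx₂⟩ := exists_sphereMap_eq_of_frequency h₁ h₃ s
  obtain ⟨y, hy, hy₁, hy₂⟩ := exists_sphereMap_eq_of_frequency h₁ h₃ s'
  have hA : (radius₁ ρ : ℂ) ≠ 0 := by exact_mod_cast (radius₁_pos h).ne'
  have hB : -Complex.I * (radius₂ ρ : ℂ) ≠ 0 :=
    mul_ne_zero (neg_ne_zero.2 Complex.I_ne_zero) (by exact_mod_cast (radius₂_pos h).ne')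
  have hb' : (b : ℂ) ≠ 0 := by exact_mod_cast hb.ne'
  constructor
  · intro hss
    have hxy : x = y := sphereMap_injective (hx.trans (hss.trans hy.symm))
    subst hxy
    have h4 := exp_eq_exp_of_coprime hpq (mul_left_cancel₀ hB (hx₂.symm.trans hy₂))
      (mul_left_cancel₀ hA (hx₁.symm.trans hy₁))
    obtain ⟨n, hn⟩ := Complex.exp_eq_exp_iff_exists_int.1 h4
    refine ⟨-n, ?_⟩
    have hn' : (-(b * s) : ℂ) = -(b * s') + n * (2 * Real.pi) := by
      apply mul_left_cancel₀ Complex.I_ne_zero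
      push_cast at hn
      linear_combination hn
    have hn'' : -(b * s) = -(b * s') + n * (2 * Real.pi) := by exact_mod_cast hn'
    field_simp
    push_cast
    linarith
  · rintro ⟨n, rfl⟩
    have hper : ∀ m : ℤ, Complex.exp (Complex.I * m * (-(b * (s' + n * (2 * Real.pi / b))) : ℝ)) =
        Complex.exp (Complex.I * m * (-(b * s') : ℝ)) := fun m =>
      Complex.exp_eq_exp_iff_exists_int.2 ⟨-(m * n), by push_cast; field_simp; ring⟩
    rw [← hx, ← hy]
    congr 1
    apply S3.ext_complex
    · rw [hx₁, hy₁, hper]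
    · rw [hx₂, hy₂, hper]

theorem isIsoparametricKnot_symmConfig {r ρ b κ τ : ℝ} {p q : ℤ} (h : (r, ρ) ∈ paramDomain)
    (hpq : IsCoprime p q) (hb : 0 < b) (h₁ : ev₂ r ρ - ev₁ r ρ = -(q * b))
    (h₃ : ev₂ r ρ - ev₃ r ρ = -(p * b)) (hg : IsGenericTransversal (symmConfig r ρ))
    (hn : IsNaturalWith (symmConfig r ρ) (fun _ => κ) (fun _ => τ)) :
    IsIsoparametricKnot (symmConfig r ρ) κ τ := by
  have heq := symmConfig_eq_iff h hpq hb h₁ h₃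
  have hT : 0 < 2 * Real.pi / b := by positivity
  have hper : Function.Periodic (symmConfig r ρ) (2 * Real.pi / b) := fun s =>
    (heq _ _).2 ⟨1, by simp⟩
  refine ⟨⟨hg, ⟨_, hT, hper⟩, id, contDiff_id, fun t => ?_, Function.surjective_id, hn⟩,
    2 * Real.pi / b, ⟨⟨hT, hper⟩, ?_⟩, ?_⟩
  · rw [deriv_id]; exact one_pos
  · rintro T' ⟨hT', hper'⟩
    obtain ⟨n, hn⟩ := (heq _ _).1 (hper' 0)
    rw [zero_add, zero_add] at hn
    have hn0 : 0 < (n : ℝ) := pos_of_mul_pos_left (hn ▸ hT') hT.le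
    have hn1 : (1 : ℝ) ≤ n := by exact_mod_cast (Int.cast_pos.1 hn0 : 0 < n)
    rw [hn]
    exact le_mul_of_one_le_left hT.le hn1
  · rintro s ⟨hs0, hsT⟩ s' ⟨hs0', hsT'⟩ hss
    obtain ⟨n, hn⟩ := (heq _ _).1 hss
    have hlt : (n : ℝ) < 1 := by
      by_contra hc
      nlinarith
    have hgt : (-1 : ℝ) < n := by
      by_contra hc
      nlinarith
    have hn0 : n = 0 := by
      have h1 : n < 1 := by exact_mod_cast hlt
      have h2 : -1 < n := by exact_mod_cast hgt
      omega
    rw [hn, hn0]; simp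

theorem isTorusKnot_symmConfig {r ρ b : ℝ} {p q : ℤ} (h : (r, ρ) ∈ paramDomain)
    (hpq : IsCoprime p q) (hb : 0 < b) (h₁ : ev₂ r ρ - ev₁ r ρ = -(q * b))
    (h₃ : ev₂ r ρ - ev₃ r ρ = -(p * b)) : IsTorusKnot p q (range (symmConfig r ρ)) := by
  refine ⟨hpq, ?_, ?_⟩
  · rintro _ ⟨s, rfl⟩
    obtain ⟨x, hx, -⟩ := exists_sphereMap_eq r ρ s
    exact ⟨x, hx⟩
  · have hset : sphereMap ⁻¹' range (symmConfig r ρ) =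
        {x : S3 | ∃ t : ℝ, x.z₁ = radius₁ ρ * Complex.exp (Complex.I * q * t) ∧
          x.z₂ = -Complex.I * radius₂ ρ * Complex.exp (Complex.I * p * t)} := by
      ext x
      constructor
      · rintro ⟨s, hs⟩
        obtain ⟨y, hy, hy₁, hy₂⟩ := exists_sphereMap_eq_of_frequency h₁ h₃ s
        obtain rfl : y = x := sphereMap_injective (hy.trans hs)
        exact ⟨_, hy₁, hy₂⟩
      · rintro ⟨t, ht₁, ht₂⟩
        obtain ⟨y, hy, hy₁, hy₂⟩ := exists_sphereMap_eq_of_frequency h₁ h₃ (-(t / b))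
        rw [show -(b * -(t / b)) = t by field_simp] at hy₁ hy₂
        obtain rfl : y = x := S3.ext_complex (hy₁.trans ht₁.symm) (hy₂.trans ht₂.symm)
        exact ⟨_, hy.symm⟩
    rw [hset]
    exact ambientIsotopic_standardTorusKnot (radius₁_pos h) (radius₂_pos h) (radius_sq_add ρ) p q

end CRKnots

theorem proposition3p3p2 (r : ℚ) (ρ : ℝ) (hrρ : ((r : ℝ), ρ) ∈ CRKnots.paramDomain) :
    (∃ κ τ : ℝ, CRKnots.IsIsoparametricKnot (CRKnots.symmConfig r ρ) κ τ ∧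
        CRKnots.IsFirstClass κ τ ∧ CRKnots.HasSpectralRatio κ τ r) ∧
      (∃ p q : ℤ, 0 < p ∧ q < 0 ∧ IsCoprime p q ∧ (p : ℚ) / q = (2 + r) / (1 + 2 * r) ∧
        CRKnots.IsTorusKnot p q (Set.range (CRKnots.symmConfig r ρ))) ∧
      Set.range (CRKnots.symmConfig r ρ) ⊆ CRKnots.heisenbergCyclide ρ := by
  obtain ⟨p, q, hp, hq, hpq, hr, b, hb, h₁, h₃⟩ := CRKnots.exists_common_frequency r ρ hrρ
  obtain ⟨κ, τ, hg, hn, hclass, hratio⟩ := CRKnots.exists_bending_twist hrρ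
  exact ⟨⟨κ, τ, CRKnots.isIsoparametricKnot_symmConfig hrρ hpq hb h₁ h₃ hg hn, hclass, hratio⟩,
    ⟨p, q, hp, hq, hpq, hr, CRKnots.isTorusKnot_symmConfig hrρ hpq hb h₁ h₃⟩,
    CRKnots.range_symmConfig_subset_heisenbergCyclide r ρ⟩
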